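/- Setting. Let $2\le K\le N$ be integers with $K$ even and $N/K$ an integer, and let $d\ge 0$, $T\ge 1$. The items $k\in[N]$ have feature vectors $x_k\in\mathbb{R}^d$ with $\|x_k\|_2\le 1$; put $z_{j,k}=x_j-x_k$, and assume that the vectors $z_{j,k}$ span $\mathbb{R}^d$. Let $\theta_*\in\mathbb{R}^d$ with $\|\theta_*\|_2\le 1$, and let $\Theta\subseteq\mathbb{R}^d$ be a parameter set with $\theta_*\in\Theta$. Let $\mathcal{S}$ be the collection of all $K$-subsets of $[N]$ and $\Delta^{\mathcal{S}}$ the set of probability distributions on $\mathcal{S}$. For $S\in\mathcal{S}$ let $A_S$ be the matrix with columns $z_{j,k}$, where $j<k$ and $j,k\in S$, and let $\pi_*$ be a D-optimal design, that is, a maximizer over $\pi\in\Delta^{\mathcal{S}}$ of $$g(\pi)=\log\det\Big(\sum_{S\in\mathcal{S}}\pi(S)A_SA_S^\top\Big),\qquad \log 0=-\infty.$$ In each of $T$ independent interactions $\ell=1,\dots,T$, a subset $S_\ell\sim\pi_*$ is drawn and then a ranking $\sigma_\ell:[K]\to S_\ell$ (a bijection) is drawn from the Plackett–Luce model, $$\mathbb{P}(\sigma_\ell\mid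 S_\ell)=\prod_{k=1}^K\frac{\exp(x_{\sigma_\ell(k)}^\top\theta_*)}{\sum_{j=k}^K\exp(x_{\sigma_\ell(j)}^\top\theta_*)}.$$ A maximum-likelihood estimate is any minimizer $\hat\theta$ over $\Theta$ of $$\mathcal{L}_T(\theta)=-\sum_{\ell=1}^T\sum_{k=1}^K\log\frac{\exp(x_{\sigma_\ell(k)}^\top\theta)}{\sum_{j=k}^K\exp(x_{\sigma_\ell(j)}^\top\theta)}.$$ Proposition 1. With probability at least $1-\delta$, every maximum-likelihood estimate $\hat\theta$ with $\|\hat\theta\|_2\le 1$ satisfies $$\sum_{j=1}^N\sum_{k=j+1}^N\big(z_{j,k}^\top(\theta_*-\hat\theta)\big)^2=\tilde O\!\left(\frac{N^2K^4d^2\log(1/\delta)}{T}\right),$$ where $\tilde O$ has the following meaning. For every $\delta_0\in(0,1)$ there are a constant $C>0$ and an integer $p\ge 0$, depending only on $\delta_0$, such that in every setting as above and for every $\delta\in(0,\delta_0]$, with probability at least $1-\delta$ every such $\hat\theta$ satisfies $$\sum_{j=1}^N\sum_{k=j+1}^N\big(z_{j,k}^\top(\theta_*-\hat\theta)\big)^2\le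 C\,\frac{N^2K^4d^2\log(1/\delta)}{T}\,\big(1+\log(NKdT)\big)^p$$ (for $d=0$ both sides are read as $0$). -/

import Mathlib

open MeasureTheory

noncomputable section

/-- The collection of all `K`-subsets of the `N` items. -/
abbrev KSubset (N K : ℕ) : Type := {S : Finset (Fin N) // S.card = K}

/-- A ranking of some `K` of the `N` items: an injective list `σ`, where `σ k` is the item at
position `k` and position `0` is the most preferred. It is the same thing as a `K`-subset `S`
together with a bijection from the positions onto `S`. -/
abbrev Ranking (N K : ℕ) : Type := Fin K ↪ Fin N

/-- Rankings form a finite set, on which every subset is an event. -/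
instance Ranking.instMeasurableSpace (N K : ℕ) : MeasurableSpace (Ranking N K) := ⊤

/-- The `K`-subset of items that a ranking ranks. -/
def Ranking.items {N K : ℕ} (σ : Ranking N K) : KSubset N K :=
  ⟨Finset.univ.map σ, by simp⟩

/-- The factor of the Plackett–Luce likelihood that belongs to position `k`: the softmax
probability of choosing the item `σ k` among the items at the positions `j ≥ k`. -/
def plFactor {N K d : ℕ} (x : Fin N → EuclideanSpace ℝ (Fin d)) (θ : EuclideanSpace ℝ (Fin d))
    (σ : Ranking N K) (k : Fin K) : ℝ :=
  Real.exp (inner ℝ (x (σ k)) θ) / ∑ j ∈ Finset.Ici k, Real.exp (inner ℝ (x (σ j)) θ)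

/-- The Plackett–Luce probability of the ranking `σ`, given the set of items that is ranked. -/
def plProb {N K d : ℕ} (x : Fin N → EuclideanSpace ℝ (Fin d)) (θ : EuclideanSpace ℝ (Fin d))
    (σ : Ranking N K) : ℝ :=
  ∏ k, plFactor x θ σ k

/-- The law of one interaction: a `K`-subset `S` is drawn from `π`, and then a ranking of `S` is
drawn from the Plackett–Luce model with parameter `θ`. -/
def interactionLaw {N K d : ℕ} (x : Fin N → EuclideanSpace ℝ (Fin d))
    (θ : EuclideanSpace ℝ (Fin d)) (π : KSubset N K → ℝ) : Measure (Ranking N K) :=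
  ∑ σ : Ranking N K, ENNReal.ofReal (π σ.items * plProb x θ σ) • Measure.dirac σ

/-- The law of the feedback in `T` independent interactions. -/
def feedbackLaw {N K d : ℕ} (x : Fin N → EuclideanSpace ℝ (Fin d))
    (θ : EuclideanSpace ℝ (Fin d)) (π : KSubset N K → ℝ) (T : ℕ) :
    Measure (Fin T → Ranking N K) :=
  Measure.pi fun _ => interactionLaw x θ π

/-- The negative log-likelihood of the feedback `D`. -/
def negLogLik {N K d T : ℕ} (x : Fin N → EuclideanSpace ℝ (Fin d)) (D : Fin T → Ranking N K)
    (θ : EuclideanSpace ℝ (Fin d)) : ℝ :=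
  -∑ l, ∑ k, Real.log (plFactor x θ (D l) k)

/-- `θhat` is a maximum-likelihood estimate over the parameter set `Θ` from the feedback `D`. -/
def IsMLE {N K d T : ℕ} (x : Fin N → EuclideanSpace ℝ (Fin d))
    (Θ : Set (EuclideanSpace ℝ (Fin d))) (D : Fin T → Ranking N K)
    (θhat : EuclideanSpace ℝ (Fin d)) : Prop :=
  θhat ∈ Θ ∧ IsMinOn (negLogLik x D) Θ θhat

/-- The pairs of items of `S` whose first entry has the lower index. -/
def itemPairs {N : ℕ} (S : Finset (Fin N)) : Finset (Fin N × Fin N) :=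
  (S ×ˢ S).filter fun p => p.1 < p.2

/-- The matrix `A_S`, whose columns are the differences `x j - x k` over the pairs of `S`. -/
def pairMatrix {N d : ℕ} (x : Fin N → EuclideanSpace ℝ (Fin d)) (S : Finset (Fin N)) :
    Matrix (Fin d) (itemPairs S) ℝ :=
  Matrix.of fun i p => (x p.1.1 - x p.1.2) i

/-- The design matrix `V_π = ∑ S, π(S) A_S A_Sᵀ`. -/
def designMatrix {N K d : ℕ} (x : Fin N → EuclideanSpace ℝ (Fin d)) (π : KSubset N K → ℝ) :
    Matrix (Fin d) (Fin d) ℝ :=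
  ∑ S : KSubset N K, π S • (pairMatrix x S.1 * (pairMatrix x S.1).transpose)

/-- The objective `log det V_π`, with the value `-∞` when `V_π` is singular. -/
def designObjective {N K d : ℕ} (x : Fin N → EuclideanSpace ℝ (Fin d)) (π : KSubset N K → ℝ) :
    EReal :=
  ENNReal.log (ENNReal.ofReal (designMatrix x π).det)

/-- `π` is a D-optimal design: it maximizes `log det V_π` over the probability distributions on
the `K`-subsets of the items. -/
def IsDOptimal {N K d : ℕ} (x : Fin N → EuclideanSpace ℝ (Fin d)) (π : KSubset N K → ℝ) : Prop :=
  π ∈ stdSimplex ℝ (KSubset N K) ∧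
    IsMaxOn (designObjective x) (stdSimplex ℝ (KSubset N K)) π

/-- The sum over all pairs `j < k` of items of the squared prediction errors. -/
def pairError {N d : ℕ} (x : Fin N → EuclideanSpace ℝ (Fin d))
    (θ θhat : EuclideanSpace ℝ (Fin d)) : ℝ :=
  ∑ j, ∑ k ∈ Finset.Ioi j, (inner ℝ (x j - x k) (θ - θhat)) ^ 2

end

/-! Factor the optimal design matrix as `V = Bᵀ B` and pass to `w k = B⁻ᵀ x k`, `u = B (θhat -
θstar)`, so that `⟨x k, θhat - θstar⟩ = ⟨w k, u⟩`. The Kiefer–Wolfowitz bound `IsDOptimal.trace_le`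
gives `∑ i, j ∈ S, ‖w i - w j‖² ≤ 2d` for every `K`-subset `S`. Since any two items share such a
subset, each squared prediction error is at most `2d ‖u‖²`, and it remains to bound `‖u‖`.

The log-likelihood is strongly concave in the logits (`plScore_add_le_sum_log_sub`). Since `θhat` is
at least as likely as `θstar`, the empirical quadratic form at `u`, times a constant over `K²`, is
at most the score paired with `u` (`IsMLE.norm_sq_le`). A dimension-free Hoeffding inequality in
Hilbert space (`measure_norm_sum_ge_le`) is used twice: for the centred score, whose squared norm is
of order `d (1 + log K)`, and for the empirical design as a vector of tensor squares. The second use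
makes the quadratic form at least `T ‖u‖²` for all `u` at once, provided `T ≥ 32 d² log (4/δ)`. Then
`‖u‖²` is of order `K⁴ d (1 + log K) log (4/δ) / T`. For smaller `T` the claimed bound exceeds the
trivial bound `16 N²`. -/

/-! ### Hoeffding's inequality in Hilbert space. -/

/-- `cosh (√u)` lies below its chord: it is a power series in `u` with nonnegative coefficients. -/
theorem cosh_le_of_sq_eq {w a b p q : ℝ} (hp : 0 ≤ p) (hq : 0 ≤ q) (hpq : p + q = 1)
    (hw : w ^ 2 ≤ p * a ^ 2 + q * b ^ 2) :
    Real.cosh w ≤ p * Real.cosh a + q * Real.cosh b := by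
  refine hasSum_le (fun n => ?_) (Real.hasSum_cosh w)
    (((Real.hasSum_cosh a).mul_left p).add ((Real.hasSum_cosh b).mul_left q))
  have h1 : (w ^ 2) ^ n ≤ (p * a ^ 2 + q * b ^ 2) ^ n := pow_le_pow_left₀ (sq_nonneg w) hw n
  have h2 := (convexOn_pow (𝕜 := ℝ) n).2 (Set.mem_Ici.2 (sq_nonneg a))
    (Set.mem_Ici.2 (sq_nonneg b)) hp hq hpq
  simp only [smul_eq_mul] at h2
  have h3 : (0 : ℝ) < ((2 * n).factorial : ℝ) := by positivity
  rw [pow_mul, pow_mul, pow_mul, ← mul_div_assoc, ← mul_div_assoc, ← add_div]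
  gcongr
  exact h1.trans h2

section Hoeffding

variable {E : Type*} [NormedAddCommGroup E] [InnerProductSpace ℝ E]

/-- A bound for `cosh ‖s + x‖` that is affine in `x` on the ball of radius `B`. -/
theorem exists_cosh_norm_add_le (s : E) {B : ℝ} (hB : 0 < B) :
    ∃ c : ℝ, ∀ x : E, ‖x‖ ≤ B →
      Real.cosh ‖s + x‖ ≤ Real.cosh ‖s‖ * Real.cosh B + c * inner ℝ s x := by
  rcases eq_or_ne s 0 with rfl | hs
  · refine ⟨0, fun x hx => ?_⟩
    simp only [zero_add, norm_zero, Real.cosh_zero, one_mul, zero_mul, add_zero]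
    rw [Real.cosh_le_cosh, abs_of_nonneg (norm_nonneg x), abs_of_pos hB]
    exact hx
  · have ha : 0 < ‖s‖ := norm_pos_iff.2 hs
    refine ⟨Real.sinh ‖s‖ * Real.sinh B / (‖s‖ * B), fun x hx => ?_⟩
    have hin := abs_le.1 ((abs_real_inner_le_norm s x).trans
      (mul_le_mul_of_nonneg_left hx ha.le))
    set t : ℝ := inner ℝ s x / (‖s‖ * B) with ht
    have hpos : 0 < ‖s‖ * B := mul_pos ha hB
    have ht1 : t ≤ 1 := by rw [ht, div_le_one hpos]; exact hin.2
    have ht2 : -1 ≤ t := by rw [ht, le_div_iff₀ hpos]; linarith [hin.1]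
    have hst : inner ℝ s x = t * (‖s‖ * B) := by rw [ht]; field_simp
    -- `‖s + x‖²` is at most the average of `(‖s‖ + B)²` and `(‖s‖ - B)²` with weights `(1 ± t) /
    -- 2`, where `t` is the normalised inner product.
    have key := cosh_le_of_sq_eq (w := ‖s + x‖) (a := ‖s‖ + B) (b := ‖s‖ - B)
      (p := (1 + t) / 2) (q := (1 - t) / 2) (by linarith) (by linarith) (by ring) (by
        rw [norm_add_sq_real, hst]
        nlinarith [pow_le_pow_left₀ (norm_nonneg x) hx 2])
    rw [Real.cosh_add, Real.cosh_sub] at key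
    calc _ ≤ _ := key
      _ = Real.cosh ‖s‖ * Real.cosh B + Real.sinh ‖s‖ * Real.sinh B * t := by ring
      _ = _ := by rw [ht]; ring

section Finite

variable [CompleteSpace E] {Ω : Type*} [Finite Ω] [MeasurableSpace Ω] [DiscreteMeasurableSpace Ω]
  (μ : Measure Ω) [IsProbabilityMeasure μ] {f : Ω → E} {B : ℝ}

/-- The affine majorant of `exists_cosh_norm_add_le` loses its linear term under a centred law. -/
theorem integral_cosh_norm_add_le (hB : 0 < B) (hf : ∀ ω, ‖f ω‖ ≤ B)
    (hmean : ∫ ω, f ω ∂μ = 0) (s : E) :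
    ∫ ω, Real.cosh ‖s + f ω‖ ∂μ ≤ Real.cosh ‖s‖ * Real.cosh B := by
  obtain ⟨c, hc⟩ := exists_cosh_norm_add_le s hB
  calc ∫ ω, Real.cosh ‖s + f ω‖ ∂μ
      ≤ ∫ ω, (Real.cosh ‖s‖ * Real.cosh B + c * inner ℝ s (f ω)) ∂μ :=
        integral_mono Integrable.of_finite Integrable.of_finite fun ω => hc _ (hf ω)
    _ = Real.cosh ‖s‖ * Real.cosh B := by
        rw [integral_add Integrable.of_finite Integrable.of_finite,
          integral_const_mul c, integral_inner Integrable.of_finite, hmean]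
        simp

/-- The starting point `s` is arbitrary so that induction can absorb the first sample into it. -/
theorem lintegral_cosh_norm_sum_le (hB : 0 < B) (hf : ∀ ω, ‖f ω‖ ≤ B)
    (hmean : ∫ ω, f ω ∂μ = 0) (T : ℕ) (s : E) :
    ∫⁻ D : Fin T → Ω, ENNReal.ofReal (Real.cosh ‖s + ∑ l, f (D l)‖) ∂(Measure.pi fun _ => μ)
      ≤ ENNReal.ofReal (Real.cosh ‖s‖ * Real.cosh B ^ T) := by
  induction T generalizing s with
  | zero => simp
  | succ n ih =>
    have hmp := measurePreserving_piFinSuccAbove (fun _ : Fin (n + 1) => μ) 0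
    let g : Ω × (Fin n → Ω) → ENNReal := fun z =>
      ENNReal.ofReal (Real.cosh ‖(s + f z.1) + ∑ l, f (z.2 l)‖)
    have h1 : ∀ D : Fin (n + 1) → Ω,
        ENNReal.ofReal (Real.cosh ‖s + ∑ l, f (D l)‖) =
        g (MeasurableEquiv.piFinSuccAbove (fun _ => Ω) 0 D) := by
      intro D
      simp only [Fin.sum_univ_succ, ← add_assoc]
      rfl
    rw [lintegral_congr h1, hmp.lintegral_comp (f := g) Measurable.of_discrete,
      lintegral_prod g (Measurable.of_discrete).aemeasurable]
    calc _ ≤ ∫⁻ ω, ENNReal.ofReal (Real.cosh ‖s + f ω‖ * Real.cosh B ^ n) ∂μ :=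
          lintegral_mono fun ω => ih (s + f ω)
      _ = ENNReal.ofReal (∫ ω, Real.cosh ‖s + f ω‖ * Real.cosh B ^ n ∂μ) := by
          rw [ofReal_integral_eq_lintegral_ofReal Integrable.of_finite]
          exact Filter.Eventually.of_forall fun ω =>
            mul_nonneg (Real.cosh_pos _).le (pow_nonneg (Real.cosh_pos _).le _)
      _ ≤ _ := by
          apply ENNReal.ofReal_le_ofReal
          rw [integral_mul_const, pow_succ']
          calc _ ≤ (Real.cosh ‖s‖ * Real.cosh B) * Real.cosh B ^ n :=
                mul_le_mul_of_nonneg_right (integral_cosh_norm_add_le μ hB hf hmean s)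
                  (pow_nonneg (Real.cosh_pos _).le _)
            _ = _ := by ring

/-- Hoeffding's inequality for sums of independent centred vectors of a Hilbert space. -/
theorem measure_norm_sum_ge_le (hB : 0 < B) (hf : ∀ ω, ‖f ω‖ ≤ B)
    (hmean : ∫ ω, f ω ∂μ = 0) {T : ℕ} (hT : 0 < T) {r : ℝ} (hr : 0 ≤ r) :
    (Measure.pi fun _ : Fin T => μ) {D | r ≤ ‖∑ l, f (D l)‖}
      ≤ ENNReal.ofReal (2 * Real.exp (-(r ^ 2 / (2 * T * B ^ 2)))) := by
  have hT' : (0 : ℝ) < T := by exact_mod_cast hT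
  rcases hr.eq_or_lt with rfl | hr
  · refine prob_le_one.trans ?_
    rw [← ENNReal.ofReal_one]
    apply ENNReal.ofReal_le_ofReal
    norm_num
  -- This scale minimises the Chernoff exponent `T c² B² / 2 - c r`.
  set c : ℝ := r / (T * B ^ 2) with hc
  have hcpos : 0 < c := by positivity
  have hmean' : ∫ ω, c • f ω ∂μ = 0 := by rw [integral_smul, hmean, smul_zero]
  have hbd : ∀ ω, ‖c • f ω‖ ≤ c * B := fun ω => by
    rw [norm_smul, Real.norm_of_nonneg hcpos.le]
    exact mul_le_mul_of_nonneg_left (hf ω) hcpos.le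
  have h1 := lintegral_cosh_norm_sum_le μ (mul_pos hcpos hB) hbd hmean' T 0
  have h2 := mul_meas_ge_le_lintegral (μ := Measure.pi fun _ : Fin T => μ)
    (f := fun D : Fin T → Ω => ENNReal.ofReal (Real.cosh ‖(0 : E) + ∑ l, c • f (D l)‖))
    Measurable.of_discrete (ENNReal.ofReal (Real.cosh (c * r)))
  have hsub : {D : Fin T → Ω | r ≤ ‖∑ l, f (D l)‖} ⊆
      {D | ENNReal.ofReal (Real.cosh (c * r)) ≤
        ENNReal.ofReal (Real.cosh ‖(0 : E) + ∑ l, c • f (D l)‖)} := by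
    intro D hD
    apply ENNReal.ofReal_le_ofReal
    rw [zero_add, ← Finset.smul_sum, norm_smul, Real.norm_of_nonneg hcpos.le, Real.cosh_le_cosh,
      abs_of_nonneg (by positivity), abs_of_nonneg (by positivity)]
    exact mul_le_mul_of_nonneg_left hD hcpos.le
  refine (measure_mono hsub).trans ?_
  have hch : 0 < Real.cosh (c * r) := Real.cosh_pos _
  have h3 := h2.trans h1
  rw [mul_comm, ← ENNReal.le_div_iff_mul_le (Or.inl (by simpa using hch)) (Or.inl (by simp)),
    ← ENNReal.ofReal_div_of_pos hch] at h3
  refine h3.trans (ENNReal.ofReal_le_ofReal ?_)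
  rw [norm_zero, Real.cosh_zero, one_mul, div_le_iff₀ hch]
  have h4 : Real.cosh (c * B) ^ T ≤ Real.exp (r ^ 2 / (2 * T * B ^ 2)) := by
    calc _ ≤ Real.exp ((c * B) ^ 2 / 2) ^ T :=
          pow_le_pow_left₀ (Real.cosh_pos _).le (Real.cosh_le_exp_half_sq _) _
      _ = _ := by
          rw [← Real.exp_nat_mul]
          congr 1
          rw [hc]
          field_simp
  have h5 : Real.exp (c * r) / 2 ≤ Real.cosh (c * r) := by
    rw [Real.cosh_eq]
    linarith [Real.exp_pos (-(c * r))]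
  have h6 : Real.exp (r ^ 2 / (2 * T * B ^ 2)) =
      Real.exp (-(r ^ 2 / (2 * T * B ^ 2))) * Real.exp (c * r) := by
    rw [← Real.exp_add]
    congr 1
    rw [hc]
    field_simp
    ring
  nlinarith [Real.exp_pos (-(r ^ 2 / (2 * T * B ^ 2)))]

end Finite

end Hoeffding

/-! ### Plackett–Luce likelihood: score and curvature. -/

section PlackettLuce

variable {α : Type*} {K : ℕ}

/-- The softmax probability, with logits `a`, of the item at position `j` among the items of `σ` at
the positions from `k` on. -/
noncomputable def stageProb (a : α → ℝ) (σ : Fin K ↪ α) (k j : Fin K) : ℝ :=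
  Real.exp (a (σ j)) / ∑ i ∈ Finset.Ici k, Real.exp (a (σ i))

/-- The score of the Plackett–Luce model at the logits `a`, for items with features `w`. -/
noncomputable def plScore {E : Type*} [AddCommGroup E] [Module ℝ E] (a : α → ℝ) (w : α → E)
    (σ : Fin K ↪ α) : E :=
  ∑ k, (w (σ k) - ∑ j ∈ Finset.Ici k, stageProb a σ k j • w (σ j))

theorem sum_exp_Ici_pos (a : α → ℝ) (σ : Fin K ↪ α) (k : Fin K) :
    0 < ∑ i ∈ Finset.Ici k, Real.exp (a (σ i)) :=
  Finset.sum_pos (fun _ _ => Real.exp_pos _) ⟨k, Finset.mem_Ici.2 le_rfl⟩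

theorem stageProb_pos (a : α → ℝ) (σ : Fin K ↪ α) (k j : Fin K) : 0 < stageProb a σ k j :=
  div_pos (Real.exp_pos _) (sum_exp_Ici_pos a σ k)

theorem sum_stageProb (a : α → ℝ) (σ : Fin K ↪ α) (k : Fin K) :
    ∑ j ∈ Finset.Ici k, stageProb a σ k j = 1 := by
  simp only [stageProb]
  rw [← Finset.sum_div, div_self (sum_exp_Ici_pos a σ k).ne']

theorem sum_Ici_succ {K : ℕ} {M : Type*} [AddCommMonoid M] (k : Fin K) (f : Fin (K + 1) → M) :
    ∑ j ∈ Finset.Ici k.succ, f j = ∑ j ∈ Finset.Ici k, f j.succ := by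
  have : Finset.Ici k.succ = (Finset.Ici k).map (Fin.succEmb K) := by
    ext j
    refine Fin.cases ?_ (fun i => ?_) j
    · simp [Fin.succ_ne_zero]
    · simp
  rw [this, Finset.sum_map]
  rfl

/-- The Plackett–Luce probabilities of the rankings of a given set of items sum to one. -/
theorem sum_prod_stageProb [Fintype α] [DecidableEq α] (a : α → ℝ) (K : ℕ) (S : Finset α)
    (hS : S.card = K) :
    ∑ σ : Fin K ↪ α with Finset.univ.map σ = S, ∏ k, stageProb a σ k k = 1 := by
  induction K generalizing S with
  | zero =>
    rw [Finset.card_eq_zero] at hS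
    subst hS
    rw [Finset.filter_true_of_mem (by simp)]
    simp
  | succ n ih =>
    have hmem : ∀ σ ∈ (Finset.univ.filter fun σ : Fin (n + 1) ↪ α => Finset.univ.map σ = S),
        σ 0 ∈ S := by
      intro σ hσ
      rw [← (Finset.mem_filter.1 hσ).2]
      simp
    -- Condition on the top item `i`: deleting it gives a ranking of `S.erase i`, and the remaining
    -- factors are the stage probabilities of that shorter ranking.
    rw [← Finset.sum_fiberwise_of_maps_to hmem]
    have hSpos : 0 < ∑ i ∈ S, Real.exp (a i) :=
      Finset.sum_pos (fun _ _ => Real.exp_pos _) (Finset.card_pos.1 (by omega))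
    have key : ∀ i ∈ S, ∑ σ ∈ (Finset.univ.filter fun σ : Fin (n + 1) ↪ α =>
        Finset.univ.map σ = S) with σ 0 = i, ∏ k, stageProb a σ k k =
        Real.exp (a i) / ∑ i ∈ S, Real.exp (a i) := by
      intro i hi
      rw [← mul_one (Real.exp (a i) / _), ← ih (S.erase i) (by rw [Finset.card_erase_of_mem hi]; omega),
        Finset.mul_sum]
      refine Finset.sum_bij (fun σ _ => (Fin.succEmb n).trans σ) ?_ ?_ ?_ ?_
      · intro σ hσ
        simp only [Finset.mem_filter, Finset.mem_univ, true_and] at hσ ⊢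
        obtain ⟨rfl, rfl⟩ := hσ
        ext j
        simp only [Finset.mem_map, Finset.mem_univ, true_and, Finset.mem_erase]
        constructor
        · rintro ⟨k, rfl⟩
          exact ⟨fun h => Fin.succ_ne_zero k (σ.injective h), ⟨k.succ, rfl⟩⟩
        · rintro ⟨h, k, rfl⟩
          refine Fin.cases (fun h => absurd rfl h) (fun k _ => ⟨k, rfl⟩) k h
      · intro σ hσ τ hτ h
        simp only [Finset.mem_filter] at hσ hτ
        ext k
        refine Fin.cases (hσ.2.trans hτ.2.symm) (fun k => ?_) k
        exact DFunLike.congr_fun h k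
      · intro e he
        simp only [Finset.mem_filter, Finset.mem_univ, true_and] at he
        have hie : i ∉ Set.range e := by
          rintro ⟨k, hk⟩
          have : i ∈ Finset.univ.map e := by rw [← hk]; simp
          rw [he] at this
          simp at this
        have hcoe := Equiv.coe_embeddingFinSucc_symm (f := ⟨e, ⟨i, hie⟩⟩)
        set σ := (Equiv.embeddingFinSucc n α).symm ⟨e, ⟨i, hie⟩⟩ with hσ
        have h0 : σ 0 = i := by rw [hcoe]; rfl
        have hs : ∀ k : Fin n, σ k.succ = e k := fun k => by rw [hcoe]; rfl
        refine ⟨σ, ?_, ?_⟩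
        · simp only [Finset.mem_filter, Finset.mem_univ, true_and]
          refine ⟨?_, h0⟩
          rw [← Finset.insert_erase hi, ← he]
          ext j
          simp only [Finset.mem_map, Finset.mem_univ, true_and, Finset.mem_insert]
          rw [Fin.exists_fin_succ]
          simp only [h0, hs]
          tauto
        · ext k
          exact hs k
      · intro σ hσ
        simp only [Finset.mem_filter, Finset.mem_univ, true_and] at hσ
        rw [Fin.prod_univ_succ]
        congr 1
        · simp only [stageProb]
          rw [hσ.2, ← hσ.1, Finset.sum_map]
          congr 2
          ext j
          simp
        · refine Finset.prod_congr rfl fun k _ => ?_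
          simp only [stageProb]
          rw [sum_Ici_succ]
          rfl
    rw [Finset.sum_congr rfl key, ← Finset.sum_div, div_self hSpos.ne']

/-- The score has mean zero, given the set of items that is ranked. -/
theorem sum_prod_stageProb_mul_plScore [Fintype α] [DecidableEq α] (a b : α → ℝ)
    (S : Finset α) (hS : S.card = K) :
    ∑ σ : Fin K ↪ α with Finset.univ.map σ = S,
      (∏ k, stageProb a σ k k) * plScore a b σ = 0 := by
  have hstage : ∀ (σ : Fin K ↪ α) (k : Fin K),
      HasDerivAt (fun t : ℝ => stageProb (fun i => a i + t * b i) σ k k)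
        (stageProb a σ k k * (b (σ k) - ∑ j ∈ Finset.Ici k, stageProb a σ k j * b (σ j))) 0 := by
    intro σ k
    have he : ∀ j : Fin K, HasDerivAt (fun t : ℝ => Real.exp (a (σ j) + t * b (σ j)))
        (Real.exp (a (σ j)) * b (σ j)) 0 := by
      intro j
      have := (((hasDerivAt_id (0 : ℝ)).mul_const (b (σ j))).const_add (a (σ j))).exp
      simpa using this
    have hs := HasDerivAt.fun_sum (u := Finset.Ici k) fun j _ => he j
    have hpos := sum_exp_Ici_pos a σ k
    have hd := (he k).fun_div hs (by simpa using hpos.ne')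
    simp only [stageProb]
    refine hd.congr_deriv ?_
    simp only [zero_mul, add_zero]
    have : ∑ j ∈ Finset.Ici k, Real.exp (a (σ j)) / (∑ i ∈ Finset.Ici k, Real.exp (a (σ i))) *
        b (σ j) = (∑ j ∈ Finset.Ici k, Real.exp (a (σ j)) * b (σ j)) /
          ∑ i ∈ Finset.Ici k, Real.exp (a (σ i)) := by
      rw [Finset.sum_div]
      exact Finset.sum_congr rfl fun j _ => by ring
    rw [this]
    field_simp
  have hprod : ∀ σ : Fin K ↪ α,
      HasDerivAt (fun t : ℝ => ∏ k, stageProb (fun i => a i + t * b i) σ k k)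
        ((∏ k, stageProb a σ k k) * plScore a b σ) 0 := by
    intro σ
    refine (HasDerivAt.fun_finsetProd fun k _ => hstage σ k).congr_deriv ?_
    simp only [zero_mul, add_zero, smul_eq_mul, plScore]
    rw [Finset.mul_sum]
    refine Finset.sum_congr rfl fun k _ => ?_
    rw [← Finset.mul_prod_erase _ _ (Finset.mem_univ k)]
    ring
  -- Total probability stays one along the logits `a + t b`, so its derivative at `t = 0`, which is
  -- the mean score in direction `b`, vanishes.
  have hsum := HasDerivAt.fun_sum
    (u := Finset.univ.filter fun σ : Fin K ↪ α => Finset.univ.map σ = S) fun σ _ => hprod σ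
  simp only [sum_prod_stageProb _ K S hS] at hsum
  exact hsum.unique (hasDerivAt_const _ _)

/-- Reduces statements about the vector score to scalar directions, where the score is a directional
derivative of the log-likelihood. -/
theorem inner_plScore {E : Type*} [NormedAddCommGroup E] [InnerProductSpace ℝ E] (a : α → ℝ)
    (w : α → E) (σ : Fin K ↪ α) (u : E) :
    inner ℝ (plScore a w σ) u = plScore a (fun i => inner ℝ (w i) u) σ := by
  simp only [plScore, sum_inner, inner_sub_left, real_inner_smul_left, smul_eq_mul]

/-- Bounded logits keep every stage near uniform. The upper bound controls the size of the score,
the lower bound its curvature. -/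
theorem stageProb_mem {a : α → ℝ} (ha : ∀ i, |a i| ≤ 1) (σ : Fin K ↪ α) (k j : Fin K) :
    Real.exp (-2) / (Finset.Ici k).card ≤ stageProb a σ k j ∧
      stageProb a σ k j ≤ Real.exp 2 / (Finset.Ici k).card := by
  have hc : (0 : ℝ) < (Finset.Ici k).card := by
    exact_mod_cast Finset.card_pos.2 ⟨k, Finset.mem_Ici.2 le_rfl⟩
  have hup : ∑ i ∈ Finset.Ici k, Real.exp (a (σ i)) ≤ (Finset.Ici k).card * Real.exp 1 := by
    rw [← nsmul_eq_mul]
    exact Finset.sum_le_card_nsmul _ _ _ fun i _ => Real.exp_le_exp.2 (abs_le.1 (ha _)).2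
  have hlo : (Finset.Ici k).card * Real.exp (-1) ≤ ∑ i ∈ Finset.Ici k, Real.exp (a (σ i)) := by
    rw [← nsmul_eq_mul]
    exact Finset.card_nsmul_le_sum _ _ _ fun i _ => Real.exp_le_exp.2 (abs_le.1 (ha _)).1
  have h1 := Real.exp_le_exp.2 (abs_le.1 (ha (σ j))).1
  have h2 := Real.exp_le_exp.2 (abs_le.1 (ha (σ j))).2
  have hpos := sum_exp_Ici_pos a σ k
  have e1 : Real.exp (-2) * Real.exp 1 = Real.exp (-1) := by rw [← Real.exp_add]; norm_num
  have e2 : Real.exp 2 * Real.exp (-1) = Real.exp 1 := by rw [← Real.exp_add]; norm_num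
  constructor
  · rw [stageProb, div_le_div_iff₀ hc hpos]
    nlinarith [Real.exp_pos (-2)]
  · rw [stageProb, div_le_div_iff₀ hpos hc]
    nlinarith [Real.exp_pos 2]

theorem sum_inv_card_Ici_le (K : ℕ) :
    ∑ k : Fin K, ((Finset.Ici k).card : ℝ)⁻¹ ≤ 1 + Real.log K := by
  have h := harmonic_le_one_add_log K
  refine le_trans (le_of_eq ?_) h
  rw [harmonic, ← Fin.sum_univ_eq_sum_range (fun i => ((i + 1 : ℕ) : ℚ)⁻¹), Rat.cast_sum,
    ← Equiv.sum_comp Fin.revPerm]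
  refine Finset.sum_congr rfl fun k _ => ?_
  rw [Fin.card_Ici]
  push_cast
  simp only [Fin.revPerm_apply, Fin.val_rev]
  have : ((K - (K - (k + 1)) : ℕ) : ℝ) = (k : ℝ) + 1 := by
    have := k.2
    rw [show K - (K - (k.1 + 1)) = k + 1 by omega]
    push_cast; rfl
  rw [this]

/-- Write each stage of the score as a weighted mean of differences and apply Cauchy–Schwarz over
all pairs `j ≥ k`. At each stage the sum of squared probabilities is at most the largest one, of
order one over the number of items left; the harmonic sum over stages costs only `1 + log K`. -/
theorem norm_plScore_sq_le {E : Type*} [NormedAddCommGroup E] [NormedSpace ℝ E]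
    {a : α → ℝ} (ha : ∀ i, |a i| ≤ 1) (w : α → E) (σ : Fin K ↪ α) :
    ‖plScore a w σ‖ ^ 2 ≤
      Real.exp 2 * (1 + Real.log K) * ∑ i, ∑ j, ‖w (σ i) - w (σ j)‖ ^ 2 := by
  have h1 : plScore a w σ = ∑ k, ∑ j ∈ Finset.Ici k, stageProb a σ k j • (w (σ k) - w (σ j)) := by
    refine Finset.sum_congr rfl fun k _ => ?_
    simp only [smul_sub, Finset.sum_sub_distrib]
    rw [← Finset.sum_smul, sum_stageProb, one_smul]
  have h2 : ‖plScore a w σ‖ ≤ ∑ z ∈ Finset.univ.sigma fun k : Fin K => Finset.Ici k,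
      stageProb a σ z.1 z.2 * ‖w (σ z.1) - w (σ z.2)‖ := by
    rw [h1, ← Finset.sum_sigma Finset.univ (fun k : Fin K => Finset.Ici k)
      fun z => stageProb a σ z.1 z.2 • (w (σ z.1) - w (σ z.2))]
    refine (norm_sum_le _ _).trans (Finset.sum_le_sum fun z _ => ?_)
    rw [norm_smul, Real.norm_of_nonneg (stageProb_pos _ _ _ _).le]
  have h3 : ∑ z ∈ Finset.univ.sigma fun k : Fin K => Finset.Ici k, stageProb a σ z.1 z.2 ^ 2 ≤
      Real.exp 2 * (1 + Real.log K) := by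
    rw [Finset.sum_sigma]
    calc _ ≤ ∑ k : Fin K, Real.exp 2 * ((Finset.Ici k).card : ℝ)⁻¹ := by
          refine Finset.sum_le_sum fun k _ => ?_
          calc _ ≤ ∑ j ∈ Finset.Ici k, Real.exp 2 * ((Finset.Ici k).card : ℝ)⁻¹ *
                stageProb a σ k j := by
                refine Finset.sum_le_sum fun j _ => ?_
                rw [sq]
                exact mul_le_mul_of_nonneg_right (stageProb_mem ha σ k j).2
                  (stageProb_pos _ _ _ _).le
            _ = _ := by rw [← Finset.mul_sum, sum_stageProb, mul_one]
      _ ≤ _ := by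
          rw [← Finset.mul_sum]
          exact mul_le_mul_of_nonneg_left (sum_inv_card_Ici_le K) (Real.exp_pos _).le
  have h4 : ∑ z ∈ Finset.univ.sigma fun k : Fin K => Finset.Ici k, ‖w (σ z.1) - w (σ z.2)‖ ^ 2 ≤
      ∑ i, ∑ j, ‖w (σ i) - w (σ j)‖ ^ 2 := by
    rw [Finset.sum_sigma]
    exact Finset.sum_le_sum fun k _ =>
      Finset.sum_le_sum_of_subset_of_nonneg (Finset.subset_univ _) fun _ _ _ => sq_nonneg _
  calc _ ≤ _ := pow_le_pow_left₀ (norm_nonneg _) h2 2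
    _ ≤ _ := Finset.sum_mul_sq_le_sq_mul_sq _ _ _
    _ ≤ _ := mul_le_mul h3 h4 (Finset.sum_nonneg fun _ _ => sq_nonneg _)
        ((Finset.sum_nonneg fun _ _ => sq_nonneg _).trans h3)

/-- Compare with `(1 + y/4)⁴ ≤ exp y`, which needs `1 + y/4 ≥ 0`; the remaining gap is the square
`(y (1 + y/8))² / 4`. -/
theorem one_add_add_sq_div_le_exp {y : ℝ} (hy : -4 ≤ y) : 1 + y + y ^ 2 / 8 ≤ Real.exp y := by
  have h1 : (1 + y / 4) ^ 4 ≤ Real.exp y := by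
    calc (1 + y / 4) ^ 4 ≤ Real.exp (y / 4) ^ 4 :=
          pow_le_pow_left₀ (by linarith) (by linarith [Real.add_one_le_exp (y / 4)]) 4
      _ = Real.exp y := by rw [← Real.exp_nat_mul]; congr 1; push_cast; ring
  nlinarith [sq_nonneg (y * (1 + y / 8))]

theorem half_le_log_one_add {v : ℝ} (h0 : 0 ≤ v) (h1 : v ≤ 1) : v / 2 ≤ Real.log (1 + v) := by
  have h := Real.one_sub_inv_le_log_of_pos (show 0 < 1 + v by linarith)
  refine le_trans ?_ h
  have h3 : (1 + v)⁻¹ ≤ 1 - v / 2 := by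
    rw [inv_le_iff_one_le_mul₀ (by linarith)]
    nlinarith
  linarith

/-- The cumulant generating function of a bounded variable exceeds its mean by a multiple of its
variance. -/
theorem mean_add_variance_le_log {ι : Type*} (s : Finset ι) (p δ : ι → ℝ) (hp : ∀ i ∈ s, 0 ≤ p i)
    (hsum : ∑ i ∈ s, p i = 1) (hδ : ∀ i, |δ i| ≤ 2) :
    ∑ i ∈ s, p i * δ i + (∑ i ∈ s, p i * (δ i - ∑ j ∈ s, p j * δ j) ^ 2) / 16 ≤
      Real.log (∑ i ∈ s, p i * Real.exp (δ i)) := by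
  set m := ∑ j ∈ s, p j * δ j with hm
  set v := ∑ i ∈ s, p i * (δ i - m) ^ 2 with hv
  have hcen : ∑ i ∈ s, p i * (δ i - m) = 0 := by
    simp only [mul_sub, Finset.sum_sub_distrib]
    rw [← Finset.sum_mul, hsum, ← hm]
    ring
  have hmle : |m| ≤ 2 := by
    calc |m| ≤ ∑ j ∈ s, |p j * δ j| := Finset.abs_sum_le_sum_abs _ _
      _ ≤ ∑ j ∈ s, p j * 2 := Finset.sum_le_sum fun j hj => by
          rw [abs_mul, abs_of_nonneg (hp j hj)]
          exact mul_le_mul_of_nonneg_left (hδ j) (hp j hj)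
      _ = 2 := by rw [← Finset.sum_mul, hsum, one_mul]
  have hv0 : 0 ≤ v := Finset.sum_nonneg fun i hi => mul_nonneg (hp i hi) (sq_nonneg _)
  -- Puts `v / 8` in the range of `half_le_log_one_add`, which turns it into `v / 16`.
  have hv4 : v ≤ 4 := by
    have h : v = ∑ i ∈ s, p i * δ i ^ 2 - m ^ 2 := by
      have : v = ∑ i ∈ s, p i * δ i ^ 2 - 2 * m * ∑ i ∈ s, p i * δ i + m ^ 2 * ∑ i ∈ s, p i := by
        rw [hv, Finset.mul_sum s _ (2 * m), Finset.mul_sum s _ (m ^ 2), ← Finset.sum_sub_distrib, ← Finset.sum_add_distrib]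
        exact Finset.sum_congr rfl fun i _ => by ring
      rw [this, hsum, ← hm]
      ring
    have h2 : ∑ i ∈ s, p i * δ i ^ 2 ≤ ∑ i ∈ s, p i * 4 := Finset.sum_le_sum fun i hi => by
      refine mul_le_mul_of_nonneg_left ?_ (hp i hi)
      have := abs_le.1 (hδ i)
      nlinarith
    rw [← Finset.sum_mul, hsum] at h2
    nlinarith [sq_nonneg m]
  have hexp : 1 + v / 8 ≤ ∑ i ∈ s, p i * Real.exp (δ i - m) := by
    calc 1 + v / 8 = ∑ i ∈ s, p i * (1 + (δ i - m) + (δ i - m) ^ 2 / 8) := by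
          simp only [mul_add, Finset.sum_add_distrib, hcen, mul_one, hsum, mul_div_assoc']
          rw [← Finset.sum_div, ← hv]
          ring
      _ ≤ _ := Finset.sum_le_sum fun i hi => mul_le_mul_of_nonneg_left
          (one_add_add_sq_div_le_exp (by
            have h1 := (abs_le.1 (hδ i)).1
            have h2 := (abs_le.1 hmle).2
            linarith)) (hp i hi)
  have hfac : ∑ i ∈ s, p i * Real.exp (δ i) = Real.exp m * ∑ i ∈ s, p i * Real.exp (δ i - m) := by
    rw [Finset.mul_sum]
    refine Finset.sum_congr rfl fun i _ => ?_
    rw [Real.exp_sub]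
    field_simp
  have hpos : 0 < ∑ i ∈ s, p i * Real.exp (δ i - m) := by linarith
  rw [hfac, Real.log_mul (Real.exp_pos _).ne' hpos.ne', Real.log_exp]
  have h5 := half_le_log_one_add (v := v / 8) (by linarith) (by linarith)
  have h6 := Real.log_le_log (by linarith) hexp
  linarith

/-- The variance equals half of `∑ i, j, p i * p j * (δ i - δ j)²`. -/
theorem sq_mul_sum_sub_sq_le {ι : Type*} (s : Finset ι) (p δ : ι → ℝ) {q : ℝ} (hq : 0 ≤ q)
    (hp : ∀ i ∈ s, q ≤ p i) (hsum : ∑ i ∈ s, p i = 1) :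
    q ^ 2 * (∑ i ∈ s, ∑ j ∈ s, (δ i - δ j) ^ 2) / 2 ≤
      ∑ i ∈ s, p i * (δ i - ∑ j ∈ s, p j * δ j) ^ 2 := by
  have h1 : q ^ 2 * (∑ i ∈ s, ∑ j ∈ s, (δ i - δ j) ^ 2) ≤
      ∑ i ∈ s, ∑ j ∈ s, p i * p j * (δ i - δ j) ^ 2 := by
    rw [Finset.mul_sum]
    refine Finset.sum_le_sum fun i hi => ?_
    rw [Finset.mul_sum]
    refine Finset.sum_le_sum fun j hj => mul_le_mul_of_nonneg_right ?_ (sq_nonneg _)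
    rw [sq]
    exact mul_le_mul (hp i hi) (hp j hj) hq (hq.trans (hp i hi))
  set m := ∑ j ∈ s, p j * δ j with hm
  have h2 : ∑ i ∈ s, ∑ j ∈ s, p i * p j * (δ i - δ j) ^ 2 =
      2 * ∑ i ∈ s, p i * (δ i - m) ^ 2 := by
    have e1 : ∀ i, ∑ j ∈ s, p i * p j * (δ i - δ j) ^ 2 =
        p i * (δ i - m) ^ 2 + p i * ∑ j ∈ s, p j * (δ j - m) ^ 2 := by
      intro i
      have e2 : ∀ j, p i * p j * (δ i - δ j) ^ 2 = (p i * (δ i - m) ^ 2) * p j +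
          p i * (p j * (δ j - m) ^ 2) - 2 * (p i * (δ i - m)) * (p j * δ j) +
            2 * (p i * (δ i - m)) * m * p j := by
        intro j; ring
      simp only [e2, Finset.sum_add_distrib, Finset.sum_sub_distrib, ← Finset.mul_sum, hsum, ← hm]
      ring
    simp only [e1, Finset.sum_add_distrib]
    rw [← Finset.sum_mul, hsum]
    ring
  linarith

/-- Strong convexity of the negative Plackett–Luce log-likelihood in the logits. -/
theorem plScore_add_le_sum_log_sub (hK : 0 < K) {a b : α → ℝ} (ha : ∀ i, |a i| ≤ 1)
    (hb : ∀ i, |b i| ≤ 2) (σ : Fin K ↪ α) :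
    -plScore a b σ + Real.exp (-4) / (32 * K ^ 2) * ∑ i, ∑ j, (b (σ i) - b (σ j)) ^ 2 ≤
      ∑ k, Real.log (stageProb a σ k k) -
        ∑ k, Real.log (stageProb (fun i => a i + b i) σ k k) := by
  set m : Fin K → ℝ := fun k => ∑ j ∈ Finset.Ici k, stageProb a σ k j * b (σ j) with hm
  set v : Fin K → ℝ := fun k =>
    ∑ i ∈ Finset.Ici k, stageProb a σ k i * (b (σ i) - m k) ^ 2 with hv
  -- The log-ratio at stage `k` is the cumulant generating function of `b` under the stage
  -- distribution, minus `b (σ k)`.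
  have hstep : ∀ k : Fin K, m k - b (σ k) + v k / 16 ≤
      Real.log (stageProb a σ k k) - Real.log (stageProb (fun i => a i + b i) σ k k) := by
    intro k
    have h := mean_add_variance_le_log (Finset.Ici k) (fun j => stageProb a σ k j)
      (fun j => b (σ j)) (fun j _ => (stageProb_pos _ _ _ _).le) (sum_stageProb a σ k)
      fun j => hb _
    have hZ := sum_exp_Ici_pos a σ k
    have hZ' := sum_exp_Ici_pos (fun i => a i + b i) σ k
    have hq : ∑ j ∈ Finset.Ici k, stageProb a σ k j * Real.exp (b (σ j)) =
        (∑ j ∈ Finset.Ici k, Real.exp (a (σ j) + b (σ j))) /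
          ∑ j ∈ Finset.Ici k, Real.exp (a (σ j)) := by
      rw [Finset.sum_div]
      refine Finset.sum_congr rfl fun j _ => ?_
      rw [stageProb, Real.exp_add]
      ring
    rw [hq, Real.log_div hZ'.ne' hZ.ne'] at h
    simp only [stageProb]
    rw [Real.log_div (Real.exp_pos _).ne' hZ.ne', Real.log_div (Real.exp_pos _).ne' hZ'.ne',
      Real.log_exp, Real.log_exp]
    simp only [hv, hm]
    linarith
  have hv0 : ∀ k, 0 ≤ v k := fun k =>
    Finset.sum_nonneg fun i _ => mul_nonneg (stageProb_pos _ _ _ _).le (sq_nonneg _)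
  -- Only stage `0` is kept: it sees all `K` items, each with probability at least `exp (-2) / K`.
  -- The other variances are dropped.
  have hfirst : Real.exp (-4) / (32 * K ^ 2) * ∑ i, ∑ j, (b (σ i) - b (σ j)) ^ 2 ≤
      (∑ k, v k) / 16 := by
    have : NeZero K := ⟨hK.ne'⟩
    have huniv : Finset.Ici (0 : Fin K) = Finset.univ := by ext; simp
    have h1 := sq_mul_sum_sub_sq_le (Finset.Ici (0 : Fin K)) (fun j => stageProb a σ 0 j)
      (fun j => b (σ j)) (q := Real.exp (-2) / K) (by positivity)
      (fun j _ => by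
        have := (stageProb_mem ha σ 0 j).1
        rwa [huniv, Finset.card_univ, Fintype.card_fin] at this) (sum_stageProb a σ 0)
    have h2 : v 0 ≤ ∑ k, v k := Finset.single_le_sum (fun k _ => hv0 k) (Finset.mem_univ 0)
    have h3 : (Real.exp (-2) / K) ^ 2 = Real.exp (-4) / K ^ 2 := by
      rw [div_pow, ← Real.exp_nat_mul]
      norm_num
    have h4 : Real.exp (-4) / K ^ 2 * (∑ i, ∑ j, (b (σ i) - b (σ j)) ^ 2) / 2 ≤ v 0 := by
      rw [h3] at h1
      refine le_trans (le_of_eq ?_) h1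
      rw [huniv]
    have h5 : Real.exp (-4) / (32 * K ^ 2) * ∑ i, ∑ j, (b (σ i) - b (σ j)) ^ 2 =
        Real.exp (-4) / K ^ 2 * (∑ i, ∑ j, (b (σ i) - b (σ j)) ^ 2) / 2 / 16 := by
      field_simp
      ring
    rw [h5]
    linarith
  have hsum := Finset.sum_le_sum fun k (_ : k ∈ Finset.univ) => hstep k
  rw [Finset.sum_sub_distrib, Finset.sum_add_distrib, ← Finset.sum_div] at hsum
  have hsc : plScore a b σ = -∑ k, (m k - b (σ k)) := by
    rw [← Finset.sum_neg_distrib]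
    refine Finset.sum_congr rfl fun k _ => ?_
    simp only [hm, smul_eq_mul]
    ring
  rw [hsc]
  linarith

end PlackettLuce

/-! ### D-optimal designs and whitening. -/

section Design

variable {N K d : ℕ} {x : Fin N → EuclideanSpace ℝ (Fin d)}

theorem sum_sum_eq_two_mul_sum_itemPairs (S : Finset (Fin N)) (f : Fin N → Fin N → ℝ)
    (hsymm : ∀ i j, f i j = f j i) (hdiag : ∀ i, f i i = 0) :
    ∑ i ∈ S, ∑ j ∈ S, f i j = 2 * ∑ p ∈ itemPairs S, f p.1 p.2 := by
  have hswap : ∑ p ∈ (S ×ˢ S).filter (fun p => p.2 < p.1), f p.1 p.2 =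
      ∑ p ∈ itemPairs S, f p.1 p.2 := by
    refine Finset.sum_nbij' Prod.swap Prod.swap ?_ ?_ (fun _ _ => rfl) (fun _ _ => rfl)
      fun p _ => hsymm _ _
    · intro p hp
      simp only [itemPairs, Finset.mem_filter, Finset.mem_product, Prod.fst_swap,
        Prod.snd_swap] at hp ⊢
      tauto
    · intro p hp
      simp only [itemPairs, Finset.mem_filter, Finset.mem_product, Prod.fst_swap,
        Prod.snd_swap] at hp ⊢
      tauto
  have hsplit : ∑ p ∈ (S ×ˢ S).filter (fun p => ¬ p.1 < p.2), f p.1 p.2 =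
      ∑ p ∈ (S ×ˢ S).filter (fun p => p.2 < p.1), f p.1 p.2 := by
    symm
    refine Finset.sum_subset (fun p hp => ?_) fun p hp hp' => ?_
    · simp only [Finset.mem_filter] at hp ⊢
      exact ⟨hp.1, hp.2.not_gt⟩
    · simp only [Finset.mem_filter, not_and, not_lt] at hp hp'
      rw [le_antisymm (hp' hp.1) hp.2, hdiag]
  rw [← Finset.sum_product (f := fun p : Fin N × Fin N => f p.1 p.2),
    ← Finset.sum_filter_add_sum_filter_not (S ×ˢ S) (fun p => p.1 < p.2), hsplit, hswap, two_mul]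
  rfl

open Matrix in
theorem dotProduct_pairMatrix_mulVec (S : Finset (Fin N)) (v : EuclideanSpace ℝ (Fin d)) :
    v.ofLp ⬝ᵥ ((pairMatrix x S * (pairMatrix x S)ᵀ) *ᵥ v.ofLp) =
      ∑ p ∈ itemPairs S, (inner ℝ (x p.1 - x p.2) v) ^ 2 := by
  rw [← mulVec_mulVec, dotProduct_mulVec, ← mulVec_transpose, ← Finset.sum_coe_sort]
  simp only [dotProduct]
  refine Finset.sum_congr rfl fun p _ => ?_
  rw [sq]
  congr 1 <;>
  · simp only [mulVec, dotProduct, transpose_apply, pairMatrix, of_apply, PiLp.inner_apply]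
    exact Finset.sum_congr rfl fun i _ => by simp [mul_comm]

open Matrix in
theorem dotProduct_designMatrix_mulVec (π : KSubset N K → ℝ) (v : EuclideanSpace ℝ (Fin d)) :
    v.ofLp ⬝ᵥ (designMatrix x π *ᵥ v.ofLp) =
      ∑ S : KSubset N K, π S * ∑ p ∈ itemPairs S.1, (inner ℝ (x p.1 - x p.2) v) ^ 2 := by
  simp only [designMatrix, sum_mulVec, dotProduct_sum, smul_mulVec, dotProduct_smul,
    dotProduct_pairMatrix_mulVec, smul_eq_mul]

theorem designMatrix_posSemidef {π : KSubset N K → ℝ} (hπ : ∀ S, 0 ≤ π S) :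
    (designMatrix x π).PosSemidef := by
  refine Matrix.posSemidef_sum _ fun S _ => Matrix.PosSemidef.smul ?_ (hπ S)
  have := Matrix.posSemidef_self_mul_conjTranspose (pairMatrix x S.1)
  rwa [Matrix.conjTranspose_eq_transpose_of_trivial] at this

theorem designMatrix_add_smul (π ρ : KSubset N K → ℝ) (s t : ℝ) :
    designMatrix x (s • π + t • ρ) = s • designMatrix x π + t • designMatrix x ρ := by
  simp only [designMatrix, Finset.smul_sum, ← Finset.sum_add_distrib, smul_smul, ← add_smul]
  rfl

theorem designMatrix_single (S : KSubset N K) :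
    designMatrix x (Pi.single S 1) = pairMatrix x S.1 * (pairMatrix x S.1).transpose := by
  rw [designMatrix, Finset.sum_eq_single S]
  · simp
  · intro R _ hR
    simp [hR]
  · simp

theorem exists_kSubset_mem (hK : 2 ≤ K) (hKN : K ≤ N) (i j : Fin N) :
    ∃ S : KSubset N K, i ∈ S.1 ∧ j ∈ S.1 := by
  obtain ⟨S, hS, hc⟩ := Finset.exists_superset_card_eq (s := ({i, j} : Finset (Fin N)))
    (Finset.card_le_two.trans hK) (by simpa using hKN)
  exact ⟨⟨S, hc⟩, hS (by simp), hS (by simp)⟩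

/-- A design that charges every subset is nonsingular if the item differences span. -/
theorem designMatrix_posDef_of_pos (hK : 2 ≤ K) (hKN : K ≤ N)
    (hspan : Submodule.span ℝ (Set.range fun q : Fin N × Fin N => x q.1 - x q.2) = ⊤)
    {π : KSubset N K → ℝ} (hπ : ∀ S, 0 < π S) : (designMatrix x π).PosDef := by
  have hpsd := designMatrix_posSemidef (x := x) fun S => (hπ S).le
  refine Matrix.posDef_iff_dotProduct_mulVec.2 ⟨hpsd.1, fun v hv => ?_⟩
  have h0 := hpsd.re_dotProduct_nonneg v
  refine lt_of_le_of_ne h0 fun h => hv ?_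
  have h1 := dotProduct_designMatrix_mulVec (x := x) π (WithLp.toLp 2 v)
  have h2 : ∑ S : KSubset N K, π S * ∑ p ∈ itemPairs S.1,
      (inner ℝ (x p.1 - x p.2) (WithLp.toLp 2 v)) ^ 2 = 0 := h1.symm.trans h.symm
  rw [Finset.sum_eq_zero_iff_of_nonneg fun S _ =>
    mul_nonneg (hπ S).le (Finset.sum_nonneg fun _ _ => sq_nonneg _)] at h2
  have horth : ∀ i j : Fin N, inner ℝ (x i - x j) (WithLp.toLp 2 v) = 0 := by
    have hlt : ∀ i j : Fin N, i < j → inner ℝ (x i - x j) (WithLp.toLp 2 v) = 0 := by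
      intro i j hij
      obtain ⟨S, hi, hj⟩ := exists_kSubset_mem hK hKN i j
      have h3 := (mul_eq_zero.1 (h2 S (Finset.mem_univ S))).resolve_left (hπ S).ne'
      rw [Finset.sum_eq_zero_iff_of_nonneg fun _ _ => sq_nonneg _] at h3
      exact pow_eq_zero_iff two_ne_zero |>.1
        (h3 (i, j) (by simp [itemPairs, hi, hj, hij]))
    intro i j
    rcases lt_trichotomy i j with hij | rfl | hij
    · exact hlt i j hij
    · simp
    · rw [← neg_sub, inner_neg_left, hlt j i hij, neg_zero]
  have hall : ∀ y : EuclideanSpace ℝ (Fin d), inner ℝ y (WithLp.toLp 2 v) = 0 := by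
    intro y
    have hy : y ∈ Submodule.span ℝ (Set.range fun q : Fin N × Fin N => x q.1 - x q.2) := by
      rw [hspan]; trivial
    induction hy using Submodule.span_induction with
    | mem y hy =>
      obtain ⟨q, rfl⟩ := hy
      exact horth _ _
    | zero => simp
    | add y z _ _ hy hz => rw [inner_add_left, hy, hz, add_zero]
    | smul c y _ hy => rw [real_inner_smul_left, hy, mul_zero]
  have := inner_self_eq_zero.1 (hall (WithLp.toLp 2 v))
  simpa using this

/-- `ENNReal.ofReal` sends nonpositive determinants to `0`; a positive competitor makes a strict
inequality survive this truncation. -/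
theorem IsDOptimal.det_le {π : KSubset N K → ℝ} (hopt : IsDOptimal x π) {ρ : KSubset N K → ℝ}
    (hρ : ρ ∈ stdSimplex ℝ (KSubset N K)) (hpos : 0 < (designMatrix x ρ).det) :
    (designMatrix x ρ).det ≤ (designMatrix x π).det := by
  have h1 := ENNReal.log_strictMono.le_iff_le.1 (hopt.2 hρ)
  by_contra hlt
  exact absurd h1 (not_le.2 ((ENNReal.ofReal_lt_ofReal_iff hpos).2 (not_le.1 hlt)))

/-- The uniform design is nonsingular, so the optimal determinant is positive too. -/
theorem IsDOptimal.posDef (hK : 2 ≤ K) (hKN : K ≤ N)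
    (hspan : Submodule.span ℝ (Set.range fun q : Fin N × Fin N => x q.1 - x q.2) = ⊤)
    {π : KSubset N K → ℝ} (hopt : IsDOptimal x π) : (designMatrix x π).PosDef := by
  have : Nonempty (KSubset N K) := by
    obtain ⟨S, -⟩ := exists_kSubset_mem hK hKN ⟨0, by omega⟩ ⟨0, by omega⟩
    exact ⟨S⟩
  have hc : (0 : ℝ) < Fintype.card (KSubset N K) := by exact_mod_cast Fintype.card_pos
  have hunif : (fun _ => (Fintype.card (KSubset N K) : ℝ)⁻¹) ∈ stdSimplex ℝ (KSubset N K) := by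
    refine ⟨fun _ => by positivity, ?_⟩
    simp only [Finset.sum_const, nsmul_eq_mul, Finset.card_univ]
    exact mul_inv_cancel₀ hc.ne'
  have hpd := designMatrix_posDef_of_pos hK hKN hspan
    (π := fun _ => (Fintype.card (KSubset N K) : ℝ)⁻¹) fun _ => by positivity
  have hdet := hpd.det_pos.trans_le (hopt.det_le hunif hpd.det_pos)
  exact (designMatrix_posSemidef hopt.1.1).posDef_iff_det_ne_zero.2 hdet.ne'

/-- The Kiefer–Wolfowitz bound for a D-optimal design. -/
theorem IsDOptimal.trace_le {π : KSubset N K → ℝ} (hopt : IsDOptimal x π)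
    (hpd : (designMatrix x π).PosDef) (S : KSubset N K) :
    ((designMatrix x π)⁻¹ * (pairMatrix x S.1 * (pairMatrix x S.1).transpose)).trace ≤ d := by
  set V := designMatrix x π with hV
  set M := pairMatrix x S.1 * (pairMatrix x S.1).transpose with hM
  have hVdet : 0 < V.det := hpd.det_pos
  have hunit : IsUnit V.det := hVdet.ne'.isUnit
  set R := V⁻¹ * M - 1 with hR
  -- Moving mass `t` from `π` to `S` multiplies the determinant by `det (1 + t R) = 1 + t tr R +
  -- c(t) t²`. Optimality, division by `t` and `t → 0` give `tr R ≤ 0`.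
  set c : ℝ → ℝ := fun t =>
    Polynomial.eval t (1 + (Polynomial.X : Polynomial ℝ) • R.map Polynomial.C).det.divX.divX with hc
  have hle : ∀ t : ℝ, 0 < t → t < 1 → R.trace + c t * t ≤ 0 := by
    intro t ht0 ht1
    have hmem : (1 - t) • π + t • (Pi.single S 1 : KSubset N K → ℝ) ∈
        stdSimplex ℝ (KSubset N K) :=
      convex_stdSimplex ℝ _ hopt.1 (single_mem_stdSimplex ℝ S) (by linarith) ht0.le (by ring)
    have hmat : designMatrix x ((1 - t) • π + t • (Pi.single S 1 : KSubset N K → ℝ)) =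
        V * (1 + t • R) := by
      rw [designMatrix_add_smul, designMatrix_single, ← hV, ← hM, hR, mul_add, mul_one,
        Matrix.mul_smul, mul_sub, mul_one, Matrix.mul_nonsing_inv_cancel_left _ _ hunit, smul_sub,
        sub_smul, one_smul]
      abel
    have hdet : (V * (1 + t • R)).det ≤ V.det := by
      rcases le_or_gt (V * (1 + t • R)).det 0 with h | h
      · exact h.trans hVdet.le
      · rw [← hmat] at h ⊢
        exact hopt.det_le hmem h
    rw [Matrix.det_mul, Matrix.det_one_add_smul] at hdet
    have h1 : t * (R.trace + c t * t) ≤ 0 := by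
      have := (mul_le_iff_le_one_right hVdet).1 hdet
      simp only [hc]
      linarith
    exact nonpos_of_mul_nonpos_right h1 ht0
  have hcont : Continuous fun t : ℝ => R.trace + c t * t := by
    simp only [hc]
    fun_prop
  have hlim : Filter.Tendsto (fun t : ℝ => R.trace + c t * t) (nhdsWithin 0 (Set.Ioi 0))
      (nhds R.trace) := by
    have := hcont.tendsto 0
    simp only [mul_zero, add_zero] at this
    exact this.mono_left nhdsWithin_le_nhds
  have htr : R.trace ≤ 0 := by
    refine le_of_tendsto hlim ?_
    filter_upwards [Ioo_mem_nhdsGT (zero_lt_one : (0 : ℝ) < 1)] with t ht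
    exact hle t ht.1 ht.2
  rw [hR, Matrix.trace_sub, Matrix.trace_one, Fintype.card_fin] at htr
  linarith

open scoped MatrixOrder in
/-- Coordinates in which the design matrix of a D-optimal design is the identity. -/
theorem IsDOptimal.exists_whitening (hK : 2 ≤ K) (hKN : K ≤ N)
    (hspan : Submodule.span ℝ (Set.range fun q : Fin N × Fin N => x q.1 - x q.2) = ⊤)
    {π : KSubset N K → ℝ} (hopt : IsDOptimal x π) :
    ∃ (w : Fin N → EuclideanSpace ℝ (Fin d))
      (B : EuclideanSpace ℝ (Fin d) →ₗ[ℝ] EuclideanSpace ℝ (Fin d)),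
      (∀ k v, inner ℝ (x k) v = inner ℝ (w k) (B v)) ∧
      (∀ u, ∑ S : KSubset N K, π S * ∑ i ∈ S.1, ∑ j ∈ S.1, (inner ℝ (w i - w j) u) ^ 2 =
        2 * ‖u‖ ^ 2) ∧
      ∀ S : KSubset N K, ∑ i ∈ S.1, ∑ j ∈ S.1, ‖w i - w j‖ ^ 2 ≤ 2 * d := by
  have hpd := hopt.posDef hK hKN hspan
  obtain ⟨B, hB⟩ := CStarAlgebra.nonneg_iff_eq_star_mul_self.1 hpd.posSemidef.nonneg
  rw [Matrix.star_eq_conjTranspose, Matrix.conjTranspose_eq_transpose_of_trivial] at hB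
  have hBunit : IsUnit B.det := by
    have h := hpd.det_pos.ne'
    rw [hB, Matrix.det_mul] at h
    exact (right_ne_zero_of_mul h).isUnit
  have hadj : ∀ y v : EuclideanSpace ℝ (Fin d), inner ℝ y v =
      inner ℝ (Matrix.toEuclideanLin B⁻¹.transpose y) (Matrix.toEuclideanLin B v) := by
    intro y v
    have e : ∀ a b : EuclideanSpace ℝ (Fin d), inner ℝ a b = a.ofLp ⬝ᵥ b.ofLp := by
      intro a b
      simp only [PiLp.inner_apply, dotProduct]
      exact Finset.sum_congr rfl fun i _ => by simp [mul_comm]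
    rw [e, e]
    simp only [Matrix.toLpLin_apply]
    rw [Matrix.mulVec_transpose, ← Matrix.dotProduct_mulVec, Matrix.mulVec_mulVec,
      Matrix.nonsing_inv_mul _ hBunit, Matrix.one_mulVec]
  refine ⟨fun k => Matrix.toEuclideanLin B⁻¹.transpose (x k), Matrix.toEuclideanLin B,
    fun k v => hadj _ v, fun u => ?_, fun S => ?_⟩
  · obtain ⟨v, rfl⟩ : ∃ v, Matrix.toEuclideanLin B v = u := by
      refine ⟨Matrix.toEuclideanLin B⁻¹ u, ?_⟩
      simp only [Matrix.toLpLin_apply, Matrix.mulVec_mulVec]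
      rw [Matrix.mul_nonsing_inv _ hBunit, Matrix.one_mulVec]
    have h1 : ∀ S : KSubset N K, ∑ i ∈ S.1, ∑ j ∈ S.1,
        (inner ℝ (Matrix.toEuclideanLin B⁻¹.transpose (x i) -
          Matrix.toEuclideanLin B⁻¹.transpose (x j)) (Matrix.toEuclideanLin B v)) ^ 2 =
        2 * ∑ p ∈ itemPairs S.1, (inner ℝ (x p.1 - x p.2) v) ^ 2 := by
      intro S
      simp only [← map_sub, ← hadj]
      refine sum_sum_eq_two_mul_sum_itemPairs S.1 (fun i j => (inner ℝ (x i - x j) v) ^ 2) ?_ ?_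
      · intro i j
        rw [← neg_sub, inner_neg_left, neg_sq]
      · intro i
        simp
    simp only [h1, mul_left_comm _ (2 : ℝ)]
    rw [← Finset.mul_sum, ← dotProduct_designMatrix_mulVec, hB, ← Matrix.mulVec_mulVec,
      Matrix.dotProduct_mulVec, ← Matrix.mulVec_transpose, Matrix.transpose_transpose,
      EuclideanSpace.real_norm_sq_eq]
    simp only [dotProduct, Matrix.toLpLin_apply, sq]
  · have h1 := sum_sum_eq_two_mul_sum_itemPairs S.1
      (fun i j => ‖Matrix.toEuclideanLin B⁻¹.transpose (x i) -
          Matrix.toEuclideanLin B⁻¹.transpose (x j)‖ ^ 2)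
      (fun i j => by rw [norm_sub_rev]) (fun i => by simp)
    rw [h1]
    refine mul_le_mul_of_nonneg_left ?_ zero_le_two
    -- As `V⁻¹ = B⁻¹ B⁻ᵀ`, cyclicity makes the trace the squared Frobenius norm of `B⁻ᵀ A_S`, whose
    -- columns are the whitened differences.
    refine le_trans (le_of_eq ?_) (hopt.trace_le hpd S)
    rw [hB, Matrix.mul_inv_rev, ← Matrix.transpose_nonsing_inv, Matrix.mul_assoc,
      Matrix.trace_mul_comm, ← Matrix.mul_assoc, Matrix.mul_assoc, Matrix.trace_mul_comm,
      ← Finset.sum_coe_sort]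
    simp only [← map_sub, Matrix.trace, Matrix.diag]
    refine Finset.sum_congr rfl fun p _ => ?_
    rw [EuclideanSpace.real_norm_sq_eq, Matrix.mul_apply]
    refine Finset.sum_congr rfl fun i _ => ?_
    rw [sq]
    congr 1
    simp only [Matrix.toLpLin_apply, Matrix.mulVec, dotProduct, Matrix.mul_apply,
      Matrix.transpose_apply, pairMatrix, Matrix.of_apply]
    exact Finset.sum_congr rfl fun j _ => mul_comm _ _

end Design

/-! ### The law of the feedback, concentration, and the likelihood comparison. -/

section Interaction

variable {N K d : ℕ} {x : Fin N → EuclideanSpace ℝ (Fin d)} {θ : EuclideanSpace ℝ (Fin d)}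
  {π : KSubset N K → ℝ}

theorem plProb_eq_prod_stageProb (σ : Ranking N K) :
    plProb x θ σ = ∏ k, stageProb (fun i => inner ℝ (x i) θ) σ k k := rfl

theorem plProb_nonneg (σ : Ranking N K) : 0 ≤ plProb x θ σ :=
  Finset.prod_nonneg fun k _ => (stageProb_pos (fun i => inner ℝ (x i) θ) σ k k).le

theorem items_eq_iff (σ : Ranking N K) (S : KSubset N K) :
    σ.items = S ↔ Finset.univ.map σ = S.1 := Subtype.ext_iff

theorem sum_ranking_eq_sum_kSubset {E : Type*} [AddCommGroup E] [Module ℝ E]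
    (f : Ranking N K → E) :
    ∑ σ : Ranking N K, (π σ.items * plProb x θ σ) • f σ =
      ∑ S : KSubset N K, π S • ∑ σ : Ranking N K with Finset.univ.map σ = S.1,
        plProb x θ σ • f σ := by
  rw [← Finset.sum_fiberwise Finset.univ (Ranking.items (N := N) (K := K))]
  refine Finset.sum_congr rfl fun S _ => ?_
  rw [Finset.smul_sum]
  simp only [items_eq_iff]
  refine Finset.sum_congr rfl fun σ hσ => ?_
  rw [(items_eq_iff σ S).2 (Finset.mem_filter.1 hσ).2, mul_smul]

theorem sum_plProb (S : KSubset N K) :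
    ∑ σ : Ranking N K with Finset.univ.map σ = S.1, plProb x θ σ = 1 :=
  sum_prod_stageProb (fun i => inner ℝ (x i) θ) K S.1 S.2

theorem isProbabilityMeasure_interactionLaw (hπ : π ∈ stdSimplex ℝ (KSubset N K)) :
    IsProbabilityMeasure (interactionLaw x θ π) := by
  constructor
  have h := sum_ranking_eq_sum_kSubset (x := x) (θ := θ) (π := π) fun _ => (1 : ℝ)
  simp only [smul_eq_mul, mul_one, sum_plProb, hπ.2] at h
  simp only [interactionLaw, Measure.coe_finsetSum, Finset.sum_apply, Measure.smul_apply,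
    measure_univ, smul_eq_mul, mul_one]
  rw [← ENNReal.ofReal_sum_of_nonneg fun σ _ => mul_nonneg (hπ.1 _) (plProb_nonneg σ), h,
    ENNReal.ofReal_one]

theorem integral_interactionLaw {E : Type*} [NormedAddCommGroup E] [NormedSpace ℝ E]
    [CompleteSpace E] (hπ : π ∈ stdSimplex ℝ (KSubset N K)) (f : Ranking N K → E) :
    ∫ σ, f σ ∂(interactionLaw x θ π) =
      ∑ S : KSubset N K, π S • ∑ σ : Ranking N K with Finset.univ.map σ = S.1,
        plProb x θ σ • f σ := by
  have : DiscreteMeasurableSpace (Ranking N K) := ⟨fun _ => trivial⟩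
  rw [← sum_ranking_eq_sum_kSubset, interactionLaw, integral_finsetSum_measure]
  · refine Finset.sum_congr rfl fun σ _ => ?_
    rw [integral_smul_measure, integral_dirac,
      ENNReal.toReal_ofReal (mul_nonneg (hπ.1 _) (plProb_nonneg σ))]
  · intro σ _
    exact (Integrable.of_finite (μ := Measure.dirac σ)).smul_measure ENNReal.ofReal_ne_top

theorem integral_interactionLaw_items {E : Type*} [NormedAddCommGroup E] [NormedSpace ℝ E]
    [CompleteSpace E] (hπ : π ∈ stdSimplex ℝ (KSubset N K)) (f : KSubset N K → E) :
    ∫ σ, f σ.items ∂(interactionLaw x θ π) = ∑ S : KSubset N K, π S • f S := by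
  rw [integral_interactionLaw hπ]
  refine Finset.sum_congr rfl fun S _ => ?_
  congr 1
  calc _ = ∑ σ : Ranking N K with Finset.univ.map σ = S.1, plProb x θ σ • f S :=
        Finset.sum_congr rfl fun σ hσ => by
          rw [(items_eq_iff σ S).2 (Finset.mem_filter.1 hσ).2]
    _ = _ := by rw [← Finset.sum_smul, sum_plProb, one_smul]

/-- Given the drawn subset, the score is centred in each scalar direction. -/
theorem integral_plScore {E : Type*} [NormedAddCommGroup E] [InnerProductSpace ℝ E]
    [CompleteSpace E] (hπ : π ∈ stdSimplex ℝ (KSubset N K)) (w : Fin N → E) :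
    ∫ σ, plScore (fun i => inner ℝ (x i) θ) w σ ∂(interactionLaw x θ π) = 0 := by
  rw [integral_interactionLaw hπ]
  refine Finset.sum_eq_zero fun S _ => ?_
  have h : ∑ σ : Ranking N K with Finset.univ.map σ = S.1,
      plProb x θ σ • plScore (fun i => inner ℝ (x i) θ) w σ = 0 := by
    refine ext_inner_right ℝ fun u => ?_
    rw [sum_inner, inner_zero_left,
      ← sum_prod_stageProb_mul_plScore (fun i => inner ℝ (x i) θ) (fun i => inner ℝ (w i) u)
        S.1 S.2]
    refine Finset.sum_congr rfl fun σ _ => ?_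
    rw [real_inner_smul_left, inner_plScore, plProb_eq_prod_stageProb]
  rw [h, smul_zero]

theorem sum_sum_items (σ : Ranking N K) {M : Type*} [AddCommMonoid M] (f : Fin N → Fin N → M) :
    ∑ i ∈ σ.items.1, ∑ j ∈ σ.items.1, f i j = ∑ i, ∑ j, f (σ i) (σ j) := by
  simp only [Ranking.items, Finset.sum_map]

/-- The tensor square of a vector, in coordinates. -/
noncomputable def tensorSq (w : EuclideanSpace ℝ (Fin d)) : EuclideanSpace ℝ (Fin d × Fin d) :=
  WithLp.toLp 2 fun p => w p.1 * w p.2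

/-- Squared inner products become linear in the tensor square, so a single norm bound on the
deviation of the design handles every `u`, including one that depends on the data. -/
theorem inner_tensorSq (w u : EuclideanSpace ℝ (Fin d)) :
    inner ℝ (tensorSq w) (tensorSq u) = (inner ℝ w u) ^ 2 := by
  simp only [PiLp.inner_apply, tensorSq, sq, Finset.sum_mul_sum, Fintype.sum_prod_type]
  refine Finset.sum_congr rfl fun i _ => Finset.sum_congr rfl fun j _ => ?_
  simp
  ring

theorem norm_tensorSq (w : EuclideanSpace ℝ (Fin d)) : ‖tensorSq w‖ = ‖w‖ ^ 2 := by
  have h : ‖tensorSq w‖ ^ 2 = (‖w‖ ^ 2) ^ 2 := by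
    rw [← real_inner_self_eq_norm_sq, inner_tensorSq, real_inner_self_eq_norm_sq]
  exact (pow_left_inj₀ (norm_nonneg _) (sq_nonneg _) two_ne_zero).1 h

/-- The sum of the tensor squares of the differences of the items of `S`. -/
noncomputable def pairTensor (w : Fin N → EuclideanSpace ℝ (Fin d)) (S : KSubset N K) :
    EuclideanSpace ℝ (Fin d × Fin d) :=
  ∑ i ∈ S.1, ∑ j ∈ S.1, tensorSq (w i - w j)

theorem inner_pairTensor (w : Fin N → EuclideanSpace ℝ (Fin d)) (S : KSubset N K)
    (u : EuclideanSpace ℝ (Fin d)) :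
    inner ℝ (pairTensor w S) (tensorSq u) =
      ∑ i ∈ S.1, ∑ j ∈ S.1, (inner ℝ (w i - w j) u) ^ 2 := by
  simp only [pairTensor, sum_inner, inner_tensorSq]

theorem norm_pairTensor_le (w : Fin N → EuclideanSpace ℝ (Fin d)) (S : KSubset N K) :
    ‖pairTensor w S‖ ≤ ∑ i ∈ S.1, ∑ j ∈ S.1, ‖w i - w j‖ ^ 2 := by
  refine (norm_sum_le _ _).trans (Finset.sum_le_sum fun i _ => ?_)
  refine (norm_sum_le _ _).trans (Finset.sum_le_sum fun j _ => ?_)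
  rw [norm_tensorSq]

theorem pairError_le_of_forall {θhat : EuclideanSpace ℝ (Fin d)} {c : ℝ}
    (h : ∀ j k, (inner ℝ (x j - x k) (θ - θhat)) ^ 2 ≤ c) :
    pairError x θ θhat ≤ N ^ 2 * c := by
  calc pairError x θ θhat ≤ ∑ j : Fin N, ∑ k : Fin N, (inner ℝ (x j - x k) (θ - θhat)) ^ 2 :=
        Finset.sum_le_sum fun j _ =>
          Finset.sum_le_sum_of_subset_of_nonneg (Finset.subset_univ _) fun _ _ _ => sq_nonneg _
    _ ≤ ∑ _j : Fin N, ∑ _k : Fin N, c :=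
        Finset.sum_le_sum fun j _ => Finset.sum_le_sum fun k _ => h j k
    _ = _ := by
        simp only [Finset.sum_const, Finset.card_univ, Fintype.card_fin, nsmul_eq_mul]
        ring

theorem pairError_le_of_norm_le {θhat : EuclideanSpace ℝ (Fin d)} (hx : ∀ k, ‖x k‖ ≤ 1)
    (hθ : ‖θ‖ ≤ 1) (hhat : ‖θhat‖ ≤ 1) : pairError x θ θhat ≤ N ^ 2 * 16 := by
  refine pairError_le_of_forall fun j k => ?_
  have h1 : ‖x j - x k‖ ≤ 2 := (norm_sub_le _ _).trans (by linarith [hx j, hx k])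
  have h2 : ‖θ - θhat‖ ≤ 2 := (norm_sub_le _ _).trans (by linarith)
  have h3 : |inner ℝ (x j - x k) (θ - θhat)| ≤ 4 := (abs_real_inner_le_norm _ _).trans
    (by nlinarith [norm_nonneg (x j - x k), norm_nonneg (θ - θhat)])
  rw [← sq_abs]
  nlinarith [abs_nonneg (inner ℝ (x j - x k) (θ - θhat))]

/-- The estimation error of a constrained maximum-likelihood estimate is controlled by the norm of
the score, if the empirical design matrix is close to its mean. -/
theorem IsMLE.norm_sq_le {T : ℕ} (hT : 0 < T) (hK : 0 < K) {Θ : Set (EuclideanSpace ℝ (Fin d))}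
    {D : Fin T → Ranking N K} {θhat : EuclideanSpace ℝ (Fin d)} (hmle : IsMLE x Θ D θhat)
    (hmem : θ ∈ Θ) (hx : ∀ k, ‖x k‖ ≤ 1) (hθ : ‖θ‖ ≤ 1) (hhat : ‖θhat‖ ≤ 1)
    {w : Fin N → EuclideanSpace ℝ (Fin d)} {u : EuclideanSpace ℝ (Fin d)}
    (hwu : ∀ k, inner ℝ (x k) (θhat - θ) = inner ℝ (w k) u)
    {m : EuclideanSpace ℝ (Fin d × Fin d)} (hm : inner ℝ m (tensorSq u) = 2 * ‖u‖ ^ 2) {r : ℝ}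
    (hr : ‖∑ l, plScore (fun i => inner ℝ (x i) θ) w (D l)‖ ≤ r)
    (hdev : ‖∑ l, (pairTensor w (D l).items - m)‖ ≤ T) :
    ‖u‖ ^ 2 ≤ (32 * K ^ 2 / (Real.exp (-4) * T)) ^ 2 * r ^ 2 := by
  set a : Fin N → ℝ := fun i => inner ℝ (x i) θ with ha_def
  set b : Fin N → ℝ := fun i => inner ℝ (w i) u with hb_def
  have ha : ∀ i, |a i| ≤ 1 := fun i => (abs_real_inner_le_norm _ _).trans
    (mul_le_one₀ (hx i) (norm_nonneg _) hθ)
  have hb : ∀ i, |b i| ≤ 2 := fun i => by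
    simp only [hb_def, ← hwu]
    refine (abs_real_inner_le_norm _ _).trans ?_
    have h2 : ‖θhat - θ‖ ≤ 2 := (norm_sub_le _ _).trans (by linarith)
    nlinarith [hx i, norm_nonneg (x i), norm_nonneg (θhat - θ)]
  have hab : (fun i => a i + b i) = fun i => inner ℝ (x i) θhat := by
    funext i
    simp only [ha_def, hb_def, ← hwu, inner_sub_right]
    ring
  -- Only the comparison with `θ ∈ Θ` is used, not a first-order condition, so `Θ` need not be
  -- convex.
  have hlik : negLogLik x D θhat ≤ negLogLik x D θ := hmle.2 hmem
  have hlower := Finset.sum_le_sum fun l (_ : l ∈ Finset.univ) =>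
    plScore_add_le_sum_log_sub hK ha hb (D l)
  simp only [hab] at hlower
  have hupper : ∑ l, (∑ k, Real.log (stageProb a (D l) k k) -
      ∑ k, Real.log (stageProb (fun i => inner ℝ (x i) θhat) (D l) k k)) ≤ 0 := by
    rw [Finset.sum_sub_distrib]
    have h1 : negLogLik x D θhat =
      -∑ l, ∑ k, Real.log (stageProb (fun i => inner ℝ (x i) θhat) (D l) k k) := rfl
    have h2 : negLogLik x D θ = -∑ l, ∑ k, Real.log (stageProb a (D l) k k) := rfl
    linarith
  have hquad : ∀ l, ∑ i, ∑ j, (b ((D l) i) - b ((D l) j)) ^ 2 =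
      inner ℝ (pairTensor w (D l).items) (tensorSq u) := fun l => by
    rw [inner_pairTensor, sum_sum_items]
    simp only [hb_def, inner_sub_left]
  have hscore : ∑ l, plScore a b (D l) = inner ℝ (∑ l, plScore a w (D l)) u := by
    simp only [sum_inner, inner_plScore, hb_def]
  -- The mean contributes `2 T ‖u‖²`, and the deviation takes away at most half of it.
  have hQ : T * ‖u‖ ^ 2 ≤ ∑ l, inner ℝ (pairTensor w (D l).items) (tensorSq u) := by
    have h1 : ∑ l, inner ℝ (pairTensor w (D l).items) (tensorSq u) =
        inner ℝ (∑ l, (pairTensor w (D l).items - m)) (tensorSq u) + T * (2 * ‖u‖ ^ 2) := by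
      rw [sum_inner]
      simp only [inner_sub_left, hm]
      rw [Finset.sum_sub_distrib, Finset.sum_const, Finset.card_univ, Fintype.card_fin,
        nsmul_eq_mul, sub_add_cancel]
    have h2 := (abs_le.1 (abs_real_inner_le_norm (∑ l, (pairTensor w (D l).items - m))
      (tensorSq u))).1
    rw [norm_tensorSq] at h2
    have h3 := mul_le_mul_of_nonneg_right hdev (sq_nonneg ‖u‖)
    linarith
  have hS : inner ℝ (∑ l, plScore a w (D l)) u ≤ r * ‖u‖ :=
    (real_inner_le_norm _ _).trans (mul_le_mul_of_nonneg_right hr (norm_nonneg _))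
  simp only [hquad] at hlower
  rw [Finset.sum_add_distrib, ← Finset.mul_sum, Finset.sum_neg_distrib, hscore] at hlower
  have hT' : (0 : ℝ) < T := by exact_mod_cast hT
  have hK' : (0 : ℝ) < K := by exact_mod_cast hK
  have hc : 0 < Real.exp (-4) / (32 * (K : ℝ) ^ 2) := by positivity
  have hmain : Real.exp (-4) / (32 * K ^ 2) * (T * ‖u‖ ^ 2) ≤ r * ‖u‖ := by
    have := mul_le_mul_of_nonneg_left hQ hc.le
    linarith
  have hr0 : 0 ≤ r := (norm_nonneg _).trans hr
  have hu : ‖u‖ ≤ 32 * K ^ 2 / (Real.exp (-4) * T) * r := by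
    rcases (norm_nonneg u).eq_or_lt with h0 | h0
    · rw [← h0]
      positivity
    · have h1 : Real.exp (-4) / (32 * K ^ 2) * T * ‖u‖ ≤ r := by
        refine le_of_mul_le_mul_right ?_ h0
        linarith
      have h2 : 32 * K ^ 2 / (Real.exp (-4) * T) * (Real.exp (-4) / (32 * K ^ 2) * T * ‖u‖) =
          ‖u‖ := by
        field_simp
      rw [← h2]
      exact mul_le_mul_of_nonneg_left h1 (by positivity)
  rw [← mul_pow]
  exact pow_le_pow_left₀ (norm_nonneg _) hu 2

/-- With probability at least `1 - δ`, the score and the empirical design matrix are close to their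
means. -/
theorem feedbackLaw_concentration {T : ℕ} (hT : 0 < T) (hd : 0 < d)
    (hx : ∀ k, ‖x k‖ ≤ 1) (hθ : ‖θ‖ ≤ 1)
    (hπ : π ∈ stdSimplex ℝ (KSubset N K)) {w : Fin N → EuclideanSpace ℝ (Fin d)}
    (hw : ∀ S : KSubset N K, ∑ i ∈ S.1, ∑ j ∈ S.1, ‖w i - w j‖ ^ 2 ≤ 2 * d)
    {m : EuclideanSpace ℝ (Fin d × Fin d)} (hm : m = ∑ S : KSubset N K, π S • pairTensor w S)
    {δ : ℝ} (hδ : 0 < δ) (hδ1 : δ < 1) (hlarge : 32 * d ^ 2 * Real.log (4 / δ) ≤ T) :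
    ENNReal.ofReal (1 - δ) ≤ feedbackLaw x θ π T
      {D | ‖∑ l, plScore (fun i => inner ℝ (x i) θ) w (D l)‖ ≤
          √(2 * T * (Real.exp 2 * (1 + Real.log K) * (2 * d)) * Real.log (4 / δ)) ∧
        ‖∑ l, (pairTensor w (D l).items - m)‖ ≤ T} := by
  have : DiscreteMeasurableSpace (Ranking N K) := ⟨fun _ => trivial⟩
  have hprob := isProbabilityMeasure_interactionLaw (x := x) (θ := θ) hπ
  have hprob' : IsProbabilityMeasure (feedbackLaw x θ π T) := by
    unfold feedbackLaw; infer_instance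
  have hT' : (0 : ℝ) < T := by exact_mod_cast hT
  have hd' : (0 : ℝ) < d := by exact_mod_cast hd
  have hlogK : 0 ≤ Real.log K := Real.log_natCast_nonneg K
  set L := Real.log (4 / δ) with hL
  have hLpos : 0 < L := Real.log_pos (by rw [lt_div_iff₀ hδ]; linarith)
  -- Each of the two Hoeffding tails, with its prefactor `2`, is allotted `δ / 2`; hence `4 / δ`.
  have hexpL : 2 * Real.exp (-L) = δ / 2 := by
    rw [Real.exp_neg, hL, Real.exp_log (by positivity)]
    field_simp
    norm_num
  set B2 := Real.exp 2 * (1 + Real.log K) * (2 * d) with hB2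
  have hB2pos : 0 < B2 := by positivity
  have hscore : ∀ σ : Ranking N K,
      ‖plScore (fun i => inner ℝ (x i) θ) w σ‖ ≤ √B2 := by
    intro σ
    refine Real.le_sqrt_of_sq_le ?_
    refine (norm_plScore_sq_le (fun i => (abs_real_inner_le_norm _ _).trans
      (mul_le_one₀ (hx i) (norm_nonneg _) hθ)) w σ).trans ?_
    rw [← sum_sum_items σ fun i j => ‖w i - w j‖ ^ 2]
    exact mul_le_mul_of_nonneg_left (hw _) (by positivity)
  have h1 := measure_norm_sum_ge_le (interactionLaw x θ π) (Real.sqrt_pos.2 hB2pos) hscore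
    (integral_plScore hπ w) hT (Real.sqrt_nonneg (2 * T * B2 * L))
  have e1 : √(2 * T * B2 * L) ^ 2 / (2 * T * √B2 ^ 2) = L := by
    rw [Real.sq_sqrt (by positivity), Real.sq_sqrt hB2pos.le]
    field_simp
  rw [e1, hexpL] at h1
  have hmean : ∫ σ, pairTensor w σ.items ∂(interactionLaw x θ π) = m :=
    (integral_interactionLaw_items hπ _).trans hm.symm
  have hpt : ∀ S : KSubset N K, ‖pairTensor w S‖ ≤ 2 * d := fun S =>
    (norm_pairTensor_le w S).trans (hw S)
  have hmnorm : ‖m‖ ≤ 2 * d := by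
    rw [← hmean]
    have := norm_integral_le_of_norm_le_const (μ := interactionLaw x θ π)
      (Filter.Eventually.of_forall fun σ : Ranking N K => hpt σ.items)
    simpa using this
  have hdev : ∀ σ : Ranking N K, ‖pairTensor w σ.items - m‖ ≤ 4 * d := fun σ =>
    (norm_sub_le _ _).trans (by linarith [hpt σ.items])
  have hcen : ∫ σ, (pairTensor w σ.items - m) ∂(interactionLaw x θ π) = 0 := by
    rw [integral_sub Integrable.of_finite Integrable.of_finite, hmean]
    simp
  have h2 := measure_norm_sum_ge_le (interactionLaw x θ π) (by positivity) hdev hcen hT hT'.le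
  -- The exponent is `T / (32 d²)`, so this is exactly where `hlarge` enters.
  have e2 : 2 * Real.exp (-((T : ℝ) ^ 2 / (2 * T * (4 * d) ^ 2))) ≤ δ / 2 := by
    rw [← hexpL]
    refine mul_le_mul_of_nonneg_left (Real.exp_le_exp.2 (neg_le_neg ?_)) zero_le_two
    rw [le_div_iff₀ (by positivity)]
    nlinarith
  replace h2 := h2.trans (ENNReal.ofReal_le_ofReal e2)
  rw [ENNReal.ofReal_sub _ hδ.le, ENNReal.ofReal_one, tsub_le_iff_right,
    ← measure_univ (μ := feedbackLaw x θ π T)]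
  have hδ2 : ENNReal.ofReal δ = ENNReal.ofReal (δ / 2) + ENNReal.ofReal (δ / 2) := by
    rw [← ENNReal.ofReal_add (by positivity) (by positivity), add_halves]
  rw [hδ2]
  refine le_trans ?_ (add_le_add_right (add_le_add h1 h2) _)
  refine (measure_mono ?_).trans ((measure_union_le _ _).trans
    (add_le_add_right (measure_union_le _ _) _))
  intro D _
  by_cases hA : √(2 * T * B2 * L) ≤ ‖∑ l, plScore (fun i => inner ℝ (x i) θ) w (D l)‖
  · exact Or.inr (Or.inl hA)
  by_cases hB : (T : ℝ) ≤ ‖∑ l, (pairTensor w (D l).items - m)‖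
  · exact Or.inr (Or.inr hB)
  exact Or.inl ⟨(not_le.1 hA).le, (not_le.1 hB).le⟩

end Interaction

/-! ### Assembly of the bound. -/

theorem proposition1 (δ₀ : ℝ) (hδ₀_pos : 0 < δ₀) (hδ₀_lt : δ₀ < 1) :
    ∃ (C : ℝ) (p : ℕ), 0 < C ∧
      ∀ (N K d T : ℕ), 2 ≤ K → K ≤ N → Even K → K ∣ N → 1 ≤ T →
      ∀ x : Fin N → EuclideanSpace ℝ (Fin d),
        (∀ k, ‖x k‖ ≤ 1) →
        Submodule.span ℝ (Set.range fun q : Fin N × Fin N => x q.1 - x q.2) = ⊤ →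
      ∀ θstar : EuclideanSpace ℝ (Fin d), ‖θstar‖ ≤ 1 →
      ∀ Θ : Set (EuclideanSpace ℝ (Fin d)), θstar ∈ Θ →
      ∀ π : KSubset N K → ℝ, IsDOptimal x π →
      ∀ δ : ℝ, 0 < δ → δ ≤ δ₀ →
        ENNReal.ofReal (1 - δ) ≤
          feedbackLaw x θstar π T
            {D | ∀ θhat, IsMLE x Θ D θhat → ‖θhat‖ ≤ 1 →
              pairError x θstar θhat ≤
                C * ((N : ℝ) ^ 2 * (K : ℝ) ^ 4 * (d : ℝ) ^ 2 * Real.log (1 / δ) / (T : ℝ)) *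
                  (1 + Real.log ((N : ℝ) * (K : ℝ) * (d : ℝ) * (T : ℝ))) ^ p} := by
  have hℓ₀ : 0 < Real.log (1 / δ₀) := Real.log_pos (by rw [lt_div_iff₀ hδ₀_pos]; linarith)
  have hlog4 : 0 < Real.log 4 := Real.log_pos (by norm_num)
  -- `κ` absorbs `log 4`: `log (4/δ) ≤ κ log (1/δ)` for all `δ ≤ δ₀`.
  set κ := 1 + Real.log 4 / Real.log (1 / δ₀) with hκ
  have hκpos : 0 < κ := by positivity
  -- `8192 = 32² · 2 · 2 · 2`: the squared curvature constant, the Hoeffding factor, and `2d` twice,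
  -- from the score and from the pair bound. The exponent is `1` because the only logarithm, `1 +
  -- log K`, comes from the score.
  refine ⟨8192 * (Real.exp 2 / Real.exp (-4) ^ 2) * κ, 1, by positivity, ?_⟩
  intro N K d T hK hKN _ _ hT x hx hspan θstar hθ Θ hmem π hopt δ hδ hδle
  have hprob := isProbabilityMeasure_interactionLaw (x := x) (θ := θstar) hopt.1
  have hprob' : IsProbabilityMeasure (feedbackLaw x θstar π T) := by
    unfold feedbackLaw; infer_instance
  have htriv : ∀ s : Set (Fin T → Ranking N K), (∀ D, D ∈ s) →
      ENNReal.ofReal (1 - δ) ≤ feedbackLaw x θstar π T s := by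
    intro s hs
    rw [Set.eq_univ_of_forall hs, measure_univ, ← ENNReal.ofReal_one]
    exact ENNReal.ofReal_le_ofReal (by linarith)
  rcases Nat.eq_zero_or_pos d with rfl | hd
  · refine htriv _ fun D θhat _ _ => ?_
    have : pairError x θstar θhat = 0 := by
      simp [pairError, Subsingleton.elim (θstar - θhat) 0]
    rw [this]
    simp
  have hT' : (0 : ℝ) < T := by exact_mod_cast hT
  have hT1 : (1 : ℝ) ≤ T := by exact_mod_cast hT
  have hd1 : (1 : ℝ) ≤ d := by exact_mod_cast hd
  have hK1 : (1 : ℝ) ≤ K := by exact_mod_cast (by omega : 1 ≤ K)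
  have hN1 : (1 : ℝ) ≤ N := by exact_mod_cast (by omega : 1 ≤ N)
  have hlogK : 0 ≤ Real.log K := Real.log_natCast_nonneg K
  have hlogle : Real.log K ≤ Real.log ((N : ℝ) * K * d * T) := by
    refine Real.log_le_log (by linarith) ?_
    calc (K : ℝ) = 1 * K * 1 * 1 := by ring
      _ ≤ _ := by gcongr
  set P := Real.log ((N : ℝ) * K * d * T) with hP
  set ℓ := Real.log (1 / δ) with hℓ
  have hℓle : Real.log (1 / δ₀) ≤ ℓ :=
    Real.log_le_log (by positivity) (one_div_le_one_div_of_le hδ hδle)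
  have hLle : Real.log (4 / δ) ≤ κ * ℓ := by
    have h1 : Real.log (4 / δ) = Real.log 4 + ℓ := by
      rw [hℓ, ← Real.log_mul (by norm_num) (by positivity)]
      congr 1
      ring
    have h2 : Real.log 4 ≤ Real.log 4 / Real.log (1 / δ₀) * ℓ := by
      rw [div_mul_eq_mul_div, le_div_iff₀ hℓ₀]
      exact mul_le_mul_of_nonneg_left hℓle hlog4.le
    rw [h1, hκ]
    linarith
  have hℓpos : 0 < ℓ := hℓ₀.trans_le hℓle
  have hLpos : 0 < Real.log (4 / δ) := Real.log_pos (by rw [lt_div_iff₀ hδ]; linarith)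
  have hratio : 1 ≤ Real.exp 2 / Real.exp (-4) ^ 2 := by
    rw [one_le_div (by positivity), ← Real.exp_nat_mul]
    exact Real.exp_le_exp.2 (by norm_num)
  set ρ := Real.exp 2 / Real.exp (-4) ^ 2 with hρ
  simp only [pow_one]
  have hP0 : 0 ≤ P := hlogK.trans hlogle
  -- For small `T` the design need not concentrate, but `32 d² κ ℓ / T ≥ 1` already makes the
  -- trivial bound sufficient.
  rcases lt_or_ge (T : ℝ) (32 * d ^ 2 * Real.log (4 / δ)) with hsmall | hlarge
  · refine htriv _ fun D θhat _ hhat => (pairError_le_of_norm_le hx hθ hhat).trans ?_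
    have h1 : 1 ≤ 32 * d ^ 2 * (κ * ℓ) / T := by
      rw [one_le_div hT']
      exact hsmall.le.trans (mul_le_mul_of_nonneg_left hLle (by positivity))
    have hK4 : (1 : ℝ) ≤ K ^ 4 := one_le_pow₀ hK1
    calc (N : ℝ) ^ 2 * 16 = N ^ 2 * 16 * 1 * 1 * 1 * 1 := by ring
      _ ≤ N ^ 2 * 256 * K ^ 4 * (32 * d ^ 2 * (κ * ℓ) / T) * ρ * (1 + P) := by
          gcongr
          · norm_num
          · linarith
      _ = _ := by ring
  · obtain ⟨w, B, hwB, hwQ, hw⟩ := hopt.exists_whitening hK hKN hspan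
    refine (feedbackLaw_concentration hT hd hx hθ hopt.1 hw rfl hδ (by linarith)
      hlarge).trans (measure_mono ?_)
    rintro D ⟨hD1, hD2⟩ θhat hmle hhat
    set u := B (θhat - θstar) with hu
    have hm : inner ℝ (∑ S : KSubset N K, π S • pairTensor w S) (tensorSq u) = 2 * ‖u‖ ^ 2 := by
      simp only [sum_inner, real_inner_smul_left, inner_pairTensor]
      exact hwQ u
    have hnorm := hmle.norm_sq_le hT (by omega) hmem hx hθ hhat (fun k => hwB k _) hm hD1 hD2
    rw [Real.sq_sqrt (by positivity)] at hnorm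
    have hpair : pairError x θstar θhat ≤ N ^ 2 * (2 * d * ‖u‖ ^ 2) := by
      refine pairError_le_of_forall fun j k => ?_
      have h1 : inner ℝ (x j - x k) (θstar - θhat) = -inner ℝ (w j - w k) u := by
        rw [← neg_sub θhat θstar, inner_neg_right, inner_sub_left, inner_sub_left, hwB, hwB]
      obtain ⟨S, hj, hk⟩ := exists_kSubset_mem hK hKN j k
      have h2 : ‖w j - w k‖ ^ 2 ≤ 2 * d := by
        refine le_trans ?_ (hw S)
        refine le_trans ?_ (Finset.single_le_sum (f := fun i => ∑ j ∈ S.1, ‖w i - w j‖ ^ 2)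
          (fun i _ => Finset.sum_nonneg fun _ _ => sq_nonneg _) hj)
        exact Finset.single_le_sum (f := fun k => ‖w j - w k‖ ^ 2) (fun _ _ => sq_nonneg _) hk
      rw [h1, neg_sq, ← sq_abs]
      calc _ ≤ (‖w j - w k‖ * ‖u‖) ^ 2 :=
            pow_le_pow_left₀ (abs_nonneg _) (abs_real_inner_le_norm _ _) 2
        _ = ‖w j - w k‖ ^ 2 * ‖u‖ ^ 2 := mul_pow _ _ _
        _ ≤ _ := mul_le_mul_of_nonneg_right h2 (sq_nonneg _)
    calc pairError x θstar θhat ≤ N ^ 2 * (2 * d * ‖u‖ ^ 2) := hpair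
      _ ≤ N ^ 2 * (2 * d * ((32 * K ^ 2 / (Real.exp (-4) * T)) ^ 2 *
          (2 * T * (Real.exp 2 * (1 + Real.log K) * (2 * d)) * Real.log (4 / δ)))) := by gcongr
      _ ≤ N ^ 2 * (2 * d * ((32 * K ^ 2 / (Real.exp (-4) * T)) ^ 2 *
          (2 * T * (Real.exp 2 * (1 + P) * (2 * d)) * (κ * ℓ)))) := by gcongr
      _ = _ := by
          rw [hρ]
          field_simp
          ring
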